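/- **Setting.** Let $d,n\ge 1$ and $m\ge 2$ be integers and $r>0$. For a function $u$ write $|u|_{\Omega,m}=\max_{|\alpha|=m}\sup_{x\in\Omega}|\partial^\alpha u(x)|$. *Domain and points.* $\Omega=\bigcup_{x\in S}B_r(x)\subset\mathbb R^d$ is a union of open balls of radius $r$ with centres in a bounded set $S$, and $x_1,\dots,x_n\in\Omega$ are distinct points with fill distance $h=\sup_{x\in\Omega}\min_{i}\|x-x_i\|$. *Space.* $\mathcal H$ is a reproducing kernel Hilbert space of real functions on $\Omega$ with kernel $k$ and feature map $\phi(x)=k(x,\cdot)$, and $\mathsf M,\mathsf D_m\ge 1$ are constants such that: (a) $w|_\Omega\in\mathcal H$ for every $w\in C^\infty(\mathbb R^d)$, and $u\cdot v\in\mathcal H$ with $\|u\cdot v\|_{\mathcal H}\le \mathsf M\|u\|_{\mathcal H}\|v\|_{\mathcal H}$ for all $u,v\in\mathcal H$; (b) $a\circ(v_1,\dots,v_p)\in\mathcal H$ for all $p$, $a\in C^\infty(\mathbb R^p)$ and $v_1,\dots,v_p\in\mathcal H$; (c) for every ball $B_\rho(z)\subset\Omega$ and $u\in\mathcal H$ there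 is $g\in\mathcal H$ with $g(x)=\int_0^1(1-t)\,u(z+t(x-z))\,dt$ for all $x\in B_\rho(z)$; (d) the kernel is $m$ times continuously differentiable (the derivatives $\partial_x^\alpha\partial_y^{\alpha'} k$ with $|\alpha|,|\alpha'|\le m$ exist and are continuous on $\Omega\times\Omega$) and $\max_{|\alpha|=m}\sup_{x,y\in\Omega}|\partial_x^\alpha\partial_y^\alpha k(x,y)|\le \mathsf D_m^2$. *Function.* $f\in C^2(\mathbb R^d)$ has exactly one global minimizer $\zeta$ (over $\mathbb R^d$) in $\Omega$, its Hessian at $\zeta$ is positive definite, and $f$ has no global minimizer on $\partial\Omega$. Moreover $f|_\Omega\in\mathcal H$ and $\frac{\partial^2 f}{\partial x_i\partial x_j}|_\Omega\in\mathcal H$ for all $i,j$. Put $f_*=f(\zeta)$. Let $\beta$ satisfy $f(x)-f_*\ge\frac\beta2\|x-\zeta\|^2$ for all $x\in\Omega$, and let $0\le\nu<\beta$. *Problems.* Let $K=(k(x_i,x_j))_{i,j}=R^\top R$ be the Cholesky decomposition of the kernel matrix ($R$ upper triangular with nonnegative diagonal) and let $\Phi_i\in\mathbb R^n$ be the $i$-th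 column of $R$. For $\lambda>0$ consider the SDP $$\max_{c\in\mathbb R,\ z\in\mathbb R^d,\ B\succeq 0}\ c-\tfrac\nu2\|z\|^2-\lambda\operatorname{tr}(B)\quad\text{s.t.}\quad f(x_i)-\tfrac\nu2\|x_i\|^2+\nu x_i^\top z-c=\Phi_i^\top B\Phi_i,\quad i=1,\dots,n, \tag{1}$$ with $B\in\mathbb R^{n\times n}$, and its infinite-dimensional counterpart over bounded positive self-adjoint operators $A$ on $\mathcal H$ $$\max_{c\in\mathbb R,\ z\in\mathbb R^d,\ A\succeq0}\ c-\tfrac\nu2\|z\|^2\quad\text{s.t.}\quad f(x)-\tfrac\nu2\|x\|^2+\nu x^\top z-c=\langle\phi(x),A\phi(x)\rangle\quad\forall x\in\Omega. \tag{2}$$ **Theorem.** There is a trace-class operator $A_*$, of rank at most $d+1$, such that $(f_*+\frac\nu2\|\zeta\|^2,\zeta,A_*)$ is a solution of (2). For every $\lambda>0$ the problem (1) has a solution. Let $$\eta=C\,h^m,\qquad C=3\,\frac{(3\sqrt{2d}\,(m-1))^{2m}}{m!}.$$ If $h\le\frac{r}{18(m-1)^2}$ and $\lambda\ge 2\mathsf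 M\mathsf D_m\eta$, then for every solution $(\hat c,\hat z,\hat B)$ of (1) and every trace-class $A_*$ such that $(f_*+\frac\nu2\|\zeta\|^2,\zeta,A_*)$ is a solution of (2), $$\tfrac\nu2\|\hat z-\zeta\|^2\le 3\eta\,(|f|_{\Omega,m}+\nu)+2\lambda\operatorname{tr}(A_*),$$ $$\bigl|\hat c-\tfrac\nu2\|\hat z\|^2-f_*\bigr|\le 2\eta\,|f|_{\Omega,m}+\lambda\operatorname{tr}(A_*)+2\eta\nu,$$ $$\operatorname{tr}(\hat B)\le 2\operatorname{tr}(A_*)+2\tfrac\eta\lambda\,|f|_{\Omega,m}+2\nu\tfrac\eta\lambda.$$ -/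

import Mathlib

open scoped ContDiff Matrix

noncomputable section

namespace KernelSOS

/-- The space `ℝ^d` with its Euclidean norm. -/
abbrev Eucl (d : ℕ) : Type := EuclideanSpace ℝ (Fin d)

/-- Extension by zero of a function on `Ω` to the whole space. The set `Ω` is always open, so
derivatives at points of `Ω` are not affected by the values outside `Ω`. -/
def extendZero {E : Type*} {Ω : Set E} (u : Ω → ℝ) : E → ℝ :=
  open Classical in fun x => if h : x ∈ Ω then u ⟨x, h⟩ else 0

/-- The partial derivative `∂_{I 0} ⋯ ∂_{I (m-1)} u (x)` of order `m` along the coordinate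
directions listed in `I`. For `u` of class `C^m` it depends only on the multi-index that counts
how often each coordinate occurs in `I`, and every multi-index of order `m` arises in this way. -/
def partialDeriv {d m : ℕ} (I : Fin m → Fin d) (u : Eucl d → ℝ) (x : Eucl d) : ℝ :=
  iteratedFDeriv ℝ m u x (fun j => EuclideanSpace.single (I j) (1 : ℝ))

/-- The seminorm `|u|_{Ω,m} = max_{|α| = m} sup_{x ∈ Ω} |∂^α u (x)|`. -/
def derivSeminorm {d : ℕ} (Ω : Set (Eucl d)) (m : ℕ) (u : Eucl d → ℝ) : ℝ :=
  ⨆ I : Fin m → Fin d, ⨆ x : Ω, |partialDeriv I u x|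

/-- The fill distance `sup_{x ∈ Ω} min_i ‖x - x_i‖`. -/
def fillDistance {d n : ℕ} (Ω : Set (Eucl d)) (X : Fin n → Ω) : ℝ :=
  ⨆ x : Ω, ⨅ i : Fin n, ‖(x : Eucl d) - X i‖

/-! ### Assumptions on the domain and on the objective function -/

/-- `Ω` is the union of the open balls of radius `r > 0` centred at the points of a bounded set. -/
def IsUnionOfBalls {d : ℕ} (Ω : Set (Eucl d)) (r : ℝ) : Prop :=
  0 < r ∧ ∃ S : Set (Eucl d), Bornology.IsBounded S ∧ Ω = ⋃ x ∈ S, Metric.ball x r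

/-- `x` is a global minimizer of `f` over `ℝ^d`. -/
def IsGlobalMin {d : ℕ} (f : Eucl d → ℝ) (x : Eucl d) : Prop := ∀ y, f x ≤ f y

/-- The global minimizers of `f` that lie in `Ω`. -/
def minimizersIn {d : ℕ} (f : Eucl d → ℝ) (Ω : Set (Eucl d)) : Set (Eucl d) :=
  {x | x ∈ Ω ∧ IsGlobalMin f x}

/-- Geometric assumptions on the objective function. -/
structure GeometricAssumption {d : ℕ} (f : Eucl d → ℝ) (Ω : Set (Eucl d)) : Prop where
  contDiff : ContDiff ℝ 2 f
  nonempty : (minimizersIn f Ω).Nonempty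
  isolated : ∀ x ∈ minimizersIn f Ω, ∃ ε > 0, ∀ y ∈ minimizersIn f Ω, dist y x < ε → y = x
  hessian_pos : ∀ x ∈ minimizersIn f Ω, ∀ v : Eucl d, v ≠ 0 →
    0 < iteratedFDeriv ℝ 2 f x ![v, v]
  finite : (minimizersIn f Ω).Finite
  boundary : ∀ x ∈ frontier Ω, ¬ IsGlobalMin f x

/-! ### Reproducing kernel Hilbert spaces on `Ω` -/

section RKHS

variable {d : ℕ} {Ω : Set (Eucl d)} (H : Type*) [NormedAddCommGroup H] [InnerProductSpace ℝ H]
  [CompleteSpace H] [RKHS ℝ H Ω ℝ]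

/-- The feature map `φ(x) = k(x, ·)`. -/
def feature (x : Ω) : H := RKHS.kerFun H x (1 : ℝ)

/-- The scalar kernel `k(x, y)` on `Ω`. -/
def ker (x y : Ω) : ℝ := RKHS.kernel H x y (1 : ℝ)

theorem ker_eq_inner (x y : Ω) : ker H x y = inner ℝ (feature H x) (feature H y) := by
  rw [feature, RKHS.kerFun_inner, feature, RKHS.kerFun_apply]
  simp [ker]

/-- The kernel, extended by zero outside `Ω × Ω`. -/
def kerExt (x y : Eucl d) : ℝ :=
  extendZero (fun x' : Ω => extendZero (fun y' : Ω => ker H x' y') y) x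

/-- The mixed derivative `∂_x^I ∂_y^J k (x, y)`. -/
def kerDeriv {i j : ℕ} (I : Fin i → Fin d) (J : Fin j → Fin d) (x y : Eucl d) : ℝ :=
  partialDeriv I (fun x' => partialDeriv J (fun y' => kerExt H x' y') y) x

/-- The kernel is `m` times continuously differentiable: all the derivatives
`∂_x^α ∂_y^β k` with `|α|, |β| ≤ m` exist and are continuous on `Ω × Ω`. -/
structure KernelContDiff (m : ℕ) : Prop where
  right : ∀ x ∈ Ω, ContDiffOn ℝ m (fun y => kerExt H x y) Ω
  left : ∀ j ≤ m, ∀ J : Fin j → Fin d, ∀ y ∈ Ω,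
    ContDiffOn ℝ m (fun x => partialDeriv J (fun y' => kerExt H x y') y) Ω
  joint : ∀ i ≤ m, ∀ j ≤ m, ∀ (I : Fin i → Fin d) (J : Fin j → Fin d),
    ContinuousOn (fun p : Eucl d × Eucl d => kerDeriv H I J p.1 p.2) (Ω ×ˢ Ω)

/-- The function `u` on `ℝ^d` restricts on `Ω` to an element of `H`. -/
def RestrictsTo (u : Eucl d → ℝ) : Prop := ∃ g : H, ∀ x : Ω, g x = u x

/-- Assumptions on the space `H`, of order `m` and with constants `M`, `D`. -/
structure RichSpace (m : ℕ) (M D : ℝ) : Prop where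
  smooth_mem : ∀ w : Eucl d → ℝ, ContDiff ℝ ∞ w → RestrictsTo H w
  one_le_M : 1 ≤ M
  mul_mem : ∀ u v : H, ∃ p : H, (∀ x : Ω, p x = u x * v x) ∧ ‖p‖ ≤ M * ‖u‖ * ‖v‖
  comp_mem : ∀ (p : ℕ) (a : Eucl p → ℝ), ContDiff ℝ ∞ a → ∀ v : Fin p → H,
    ∃ g : H, ∀ x : Ω, g x = a (WithLp.toLp 2 fun j => v j x)
  integral_mem : ∀ (z : Eucl d) (r : ℝ), 0 < r → Metric.ball z r ⊆ Ω → ∀ u : H,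
    ∃ g : H, ∀ x : Ω, (x : Eucl d) ∈ Metric.ball z r →
      g x = ∫ t in (0 : ℝ)..1, (1 - t) * extendZero (fun y : Ω => u y) (z + t • ((x : Eucl d) - z))
  one_le_D : 1 ≤ D
  kernel_contDiff : KernelContDiff H m
  kernel_bound : ∀ I : Fin m → Fin d, ∀ x ∈ Ω, ∀ y ∈ Ω, |kerDeriv H I I x y| ≤ D ^ 2

/-- Analytic assumptions on the objective function: `f` is `C²` on `Ω`, and `f` and its second
derivatives belong to `H`. -/
structure AnalyticAssumption (f : Eucl d → ℝ) : Prop where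
  contDiffOn : ContDiffOn ℝ 2 f Ω
  mem : RestrictsTo H f
  deriv_mem : ∀ i j : Fin d, RestrictsTo H (partialDeriv ![i, j] f)

/-- The bounded operator `A` has trace `τ`: for every orthonormal Hilbert basis `(e_i)` the series
`∑ ⟨e_i, A e_i⟩` converges to `τ`. For a positive operator this says that `A` is trace class
and that `tr A = τ`. -/
def HasTrace {H : Type*} [NormedAddCommGroup H] [InnerProductSpace ℝ H] (A : H →L[ℝ] H)
    (τ : ℝ) : Prop :=
  ∀ (w : Set H) (b : HilbertBasis w ℝ H), HasSum (fun i => inner ℝ (b i) (A (b i))) τ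

/-- Feasible points `(c, z, A)` of the infinite-dimensional problem: `A` is a positive operator and
`f(x) - (ν/2)‖x‖² + ν xᵀz - c = ⟨φ(x), A φ(x)⟩` for all `x ∈ Ω`. -/
def IsFeasibleInf {H : Type*} [NormedAddCommGroup H] [InnerProductSpace ℝ H] [CompleteSpace H]
    [RKHS ℝ H Ω ℝ] (f : Eucl d → ℝ) (ν c : ℝ) (z : Eucl d) (A : H →L[ℝ] H) : Prop :=
  A.IsPositive ∧ ∀ x : Ω,
    f x - ν / 2 * ‖(x : Eucl d)‖ ^ 2 + ν * inner ℝ (x : Eucl d) z - c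
      = inner ℝ (feature H x) (A (feature H x))

/-- Solutions of the infinite-dimensional problem of maximizing `c - (ν/2)‖z‖²` over the feasible
points `(c, z, A)`. -/
def IsSolutionInf {H : Type*} [NormedAddCommGroup H] [InnerProductSpace ℝ H] [CompleteSpace H]
    [RKHS ℝ H Ω ℝ] (f : Eucl d → ℝ) (ν c : ℝ) (z : Eucl d) (A : H →L[ℝ] H) : Prop :=
  IsFeasibleInf f ν c z A ∧ ∀ (c' : ℝ) (z' : Eucl d) (A' : H →L[ℝ] H),
    IsFeasibleInf f ν c' z' A' → c' - ν / 2 * ‖z'‖ ^ 2 ≤ c - ν / 2 * ‖z‖ ^ 2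

end RKHS

/-! ### The Cholesky factor and the finite-dimensional problem -/

/-- `R` is an upper triangular Cholesky factor of `K`: it is upper triangular with nonnegative
diagonal and `K = Rᵀ R`. -/
structure IsCholeskyFactor {n : ℕ} (K R : Matrix (Fin n) (Fin n) ℝ) : Prop where
  upper : ∀ i j, j < i → R i j = 0
  diag_nonneg : ∀ i, 0 ≤ R i i
  factor : K = Rᵀ * R

theorem exists_isCholeskyFactor {n : ℕ} {K : Matrix (Fin n) (Fin n) ℝ} (hK : K.PosSemidef) :
    ∃ R, IsCholeskyFactor K R := by
  obtain ⟨S, hS⟩ : ∃ S : Matrix (Fin n) (Fin n) ℝ, K = Sᴴ * S := by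
    open scoped MatrixOrder in
    exact CStarAlgebra.nonneg_iff_eq_star_mul_self.mp hK.nonneg
  let v : Fin n → Eucl n := fun j => WithLp.toLp 2 fun l => S l j
  have hcard : Module.finrank ℝ (Eucl n) = Fintype.card (Fin n) := by simp
  let b := InnerProductSpace.gramSchmidtOrthonormalBasis hcard v
  refine ⟨Matrix.of fun i j => inner ℝ (b i) (v j), ?_, ?_, ?_⟩
  · intro i j hij
    exact InnerProductSpace.gramSchmidtOrthonormalBasis_inv_triangular hcard v hij
  · intro i
    by_cases hi : InnerProductSpace.gramSchmidtNormed ℝ v i = 0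
    · exact (InnerProductSpace.inner_gramSchmidtOrthonormalBasis_eq_zero hcard hi i).ge
    · have hb : b i = InnerProductSpace.gramSchmidtNormed ℝ v i :=
        InnerProductSpace.gramSchmidtOrthonormalBasis_apply hcard hi
      have hv := InnerProductSpace.gramSchmidt_def'' ℝ v i
      have hsum : inner ℝ (InnerProductSpace.gramSchmidt ℝ v i) (v i)
          = ‖InnerProductSpace.gramSchmidt ℝ v i‖ ^ 2 := by
        conv_lhs => rw [hv]
        rw [inner_add_right, inner_sum, Finset.sum_eq_zero, add_zero,
          real_inner_self_eq_norm_sq]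
        intro j hj
        rw [inner_smul_right,
          InnerProductSpace.gramSchmidt_orthogonal ℝ v (Finset.mem_Iio.1 hj).ne', mul_zero]
      change 0 ≤ inner ℝ (b i) (v i)
      rw [hb, InnerProductSpace.gramSchmidtNormed, inner_smul_left, hsum]
      simp only [RCLike.ofReal_real_eq_id, id_eq, map_inv₀, conj_trivial]
      positivity
  · ext i j
    rw [hS]
    have h := b.sum_inner_mul_inner (v i) (v j)
    simp only [Matrix.mul_apply, Matrix.transpose_apply, Matrix.of_apply,
      Matrix.conjTranspose_apply, star_trivial]
    rw [show (∑ l, inner ℝ (b l) (v i) * inner ℝ (b l) (v j)) = inner ℝ (v i) (v j) by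
      rw [← h]
      exact Finset.sum_congr rfl fun l _ => by rw [real_inner_comm]]
    simp [v, PiLp.inner_apply, mul_comm]

/-- The Cholesky factor of a positive semidefinite matrix (it is unique when the matrix is positive
definite). -/
def cholesky {n : ℕ} (K : Matrix (Fin n) (Fin n) ℝ) (hK : K.PosSemidef) :
    Matrix (Fin n) (Fin n) ℝ :=
  (exists_isCholeskyFactor hK).choose

section SDP

variable {d n : ℕ} {Ω : Set (Eucl d)} (H : Type*) [NormedAddCommGroup H] [InnerProductSpace ℝ H]
  [CompleteSpace H] [RKHS ℝ H Ω ℝ]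

/-- The kernel matrix `K_{ij} = k(x_i, x_j)`. -/
def kernelMatrix (X : Fin n → Ω) : Matrix (Fin n) (Fin n) ℝ :=
  Matrix.of fun i j => ker H (X i) (X j)

theorem kernelMatrix_posSemidef (X : Fin n → Ω) : (kernelMatrix H X).PosSemidef := by
  have h : kernelMatrix H X = Matrix.gram ℝ fun i => feature H (X i) := by
    ext i j
    simp [kernelMatrix, ker_eq_inner]
  rw [h]
  exact Matrix.posSemidef_gram ℝ fun i => feature H (X i)

/-- The vector `Φ_i ∈ ℝ^n`: the `i`-th column of the Cholesky factor of the kernel matrix. -/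
def Phi (X : Fin n → Ω) (i : Fin n) : Fin n → ℝ :=
  fun l => cholesky (kernelMatrix H X) (kernelMatrix_posSemidef H X) l i

/-- Feasible points `(c, z, B)` of the semidefinite program: `B` is positive semidefinite and
`f(x_i) - (ν/2)‖x_i‖² + ν x_iᵀz - c = Φ_iᵀ B Φ_i` for all `i`. -/
def IsFeasibleSDP (f : Eucl d → ℝ) (X : Fin n → Ω) (ν c : ℝ) (z : Eucl d)
    (B : Matrix (Fin n) (Fin n) ℝ) : Prop :=
  B.PosSemidef ∧ ∀ i : Fin n,
    f (X i) - ν / 2 * ‖(X i : Eucl d)‖ ^ 2 + ν * inner ℝ (X i : Eucl d) z - c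
      = Phi H X i ⬝ᵥ (B *ᵥ Phi H X i)

/-- Solutions of the semidefinite program of maximizing `c - (ν/2)‖z‖² - lam * tr B` over the
feasible points `(c, z, B)`. -/
def IsSolutionSDP (f : Eucl d → ℝ) (X : Fin n → Ω) (ν lam c : ℝ) (z : Eucl d)
    (B : Matrix (Fin n) (Fin n) ℝ) : Prop :=
  IsFeasibleSDP H f X ν c z B ∧
    ∀ (c' : ℝ) (z' : Eucl d) (B' : Matrix (Fin n) (Fin n) ℝ), IsFeasibleSDP H f X ν c' z' B' →
      c' - ν / 2 * ‖z'‖ ^ 2 - lam * B'.trace ≤ c - ν / 2 * ‖z‖ ^ 2 - lam * B.trace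

end SDP

/-- The quantity `η = C h^m` with `C = 3 (3 √(2d) (m-1))^{2m} / m!`, where `h` is the fill
distance. -/
def eta {d n : ℕ} (Ω : Set (Eucl d)) (X : Fin n → Ω) (m : ℕ) : ℝ :=
  3 * (3 * √(2 * (d : ℝ)) * ((m : ℝ) - 1)) ^ (2 * m) / (m.factorial : ℝ) * fillDistance Ω X ^ m

end KernelSOS

end

/-!
Write `g = f - f(ζ) - (ν/2)‖· - ζ‖²` and call `η` the constant `eta Ω X m`.

*Exactness of the infinite-dimensional problem.* Evaluating the constraint at `ζ` shows that no
feasible value exceeds `f(ζ)`, so a solution amounts to writing `g` as a sum of squares of elements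
of `H`. Near `ζ`, Taylor's formula with integral remainder gives
`g(x) = (x - ζ)ᵀ G(x) (x - ζ)` with entries of `G` in `H`, and `G(ζ)` is positive definite because
`ν < β`. The square map of a Banach algebra is locally invertible at `1`, so `G(x) = A(x)ᵀ A(x)` with
`A(x)` a smooth function of `G(x)`; this yields `d` squares near `ζ`. Away from `ζ` the function `g`
is bounded below and its square root is in `H`. A partition `sin² + cos² = 1` glues the two
(`exists_sum_squares`, `exists_isSolutionInf`).

*The semidefinite program.* The vectors `Φ_i` are the coordinates of `φ(x_i)` in an orthonormal
family, so a positive operator compresses to a feasible matrix with no larger trace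
(`exists_compression`), and a compactness argument gives a maximizer (`exists_isSolutionSDP`).

*Error bounds.* A positive semidefinite `B` defines a nonnegative `ρ ∈ H` with
`ρ(x_i) = Φ_iᵀ B Φ_i` and `‖ρ‖ ≤ M tr B` (`exists_nonneg_interpolant`). If `B` is feasible, then the
difference of the constraint function and `ρ` vanishes at the data points. Its derivatives of order
`m` are bounded by `|f|_{Ω,m} + ν + M D tr B`, where the last term comes from the derivative
reproducing property (`abs_partialDeriv_extendZero_le`), so it is at most `η` times that bound on
`Ω` (`abs_le_eta_mul`). At `ζ` this bounds the value of the program from above; the compression of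
an exact solution bounds it from below; the three estimates follow from the two inequalities.

The reproducing property for derivatives is obtained from iterated difference quotients of the
feature map, whose inner products are, by the mean value theorem, mixed derivatives of the kernel at
nearby points. The estimate for functions with scattered zeros uses a Taylor polynomial on a ball of
radius `9 (m - 1)² h`, together with the fact that the data points form a norming set for the
polynomials of degree `m - 1` there, a consequence of Markov's inequality at an endpoint.
-/

open scoped ContDiff Matrix

noncomputable section

namespace KernelSOS


/-! ### Sampling inequality for functions with scattered zeros -/

section Sampling

open Polynomial in
/-- Markov's inequality at the endpoint `1`. -/
lemma abs_derivative_eval_one_le {Q : ℝ[X]} {k : ℕ} {K : ℝ} (hdeg : Q.natDegree ≤ k) (hK : 0 < K)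
    (hQ : ∀ t ∈ Set.Icc (-1 : ℝ) 1, |Q.eval t| ≤ K) :
    |(derivative Q).eval 1| ≤ (k : ℝ) ^ 2 * K := by
  have hT : (derivative (Chebyshev.T ℝ (k : ℤ))).eval 1 = (k : ℝ) ^ 2 := by
    rw [Chebyshev.T_derivative_eq_U]
    simp [Chebyshev.U_eval_one, sq]
  have key : ∀ P : ℝ[X], P.natDegree ≤ k → (∀ t ∈ Set.Icc (-1 : ℝ) 1, |P.eval t| ≤ K) →
      (derivative P).eval 1 ≤ (k : ℝ) ^ 2 * K := by
    intro P hP hPb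
    have h1 := Chebyshev.eval_iterate_derivative_le_of_forall_abs_le_one (n := k)
      (P := C K⁻¹ * P) (k := 1) (x := 1) le_rfl
      ((degree_le_of_natDegree_le ((natDegree_C_mul_le _ _).trans hP))) (fun t ht => by
        rw [eval_mul, eval_C, abs_mul, abs_of_pos (inv_pos.2 hK), inv_mul_le_iff₀ hK, mul_one]
        exact hPb t ht)
    rw [Function.iterate_one, hT, derivative_C_mul, eval_mul, eval_C, inv_mul_le_iff₀ hK] at h1
    linarith
  refine abs_le.2 ⟨?_, key Q hdeg hQ⟩
  have := key (-Q) (by simpa using hdeg) (by simpa using hQ)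
  simp only [derivative_neg, eval_neg] at this
  linarith

open Polynomial in
/-- Growth of a bounded polynomial near the endpoint `0` of the interval `[0, L]`. It follows from
the endpoint Markov inequality on the shorter intervals `[t, L]`. -/
lemma abs_eval_sub_eval_zero_le {p : ℝ[X]} {k : ℕ} {K L s : ℝ} (hdeg : p.natDegree ≤ k)
    (hK : 0 < K) (hs : 0 ≤ s) (hsL : s < L) (hp : ∀ t ∈ Set.Icc (0 : ℝ) L, |p.eval t| ≤ K) :
    |p.eval s - p.eval 0| ≤ 2 * (k : ℝ) ^ 2 / (L - s) * K * s := by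
  have hder : ∀ t ∈ Set.Icc (0 : ℝ) s,
      ‖(derivative p).eval t‖ ≤ 2 * (k : ℝ) ^ 2 / (L - s) * K := by
    intro t ht
    have htL : 0 < L - t := by linarith [ht.2]
    -- the affine map sending `1` to `t` and `-1` to `L`
    set l : ℝ[X] := C ((L + t) / 2) - C ((L - t) / 2) * X with hl
    have hle : ∀ y, l.eval y = (L + t) / 2 - (L - t) / 2 * y := by intro y; simp [hl]
    have hldeg : l.natDegree ≤ 1 := by rw [hl]; compute_degree
    have h := abs_derivative_eval_one_le (Q := p.comp l) (k := k) (K := K) (by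
        rw [natDegree_comp]
        exact (Nat.mul_le_mul hdeg hldeg).trans (by simp)) hK (fun y hy => by
      rw [eval_comp]
      refine hp _ ⟨?_, ?_⟩ <;> rw [hle] <;> nlinarith [hy.1, hy.2, ht.1])
    have hl1 : l.eval 1 = t := by rw [hle]; ring
    have hld : derivative l = C (-((L - t) / 2)) := by simp [hl]
    rw [derivative_comp, eval_mul, eval_comp, hl1, hld, eval_C, abs_mul, abs_neg,
      abs_of_pos (by positivity : 0 < (L - t) / 2)] at h
    rw [Real.norm_eq_abs, div_mul_eq_mul_div, le_div_iff₀ (by linarith)]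
    have : |(derivative p).eval t| * (L - s) ≤ |(derivative p).eval t| * (L - t) :=
      mul_le_mul_of_nonneg_left (by linarith [ht.2]) (abs_nonneg _)
    linarith
  have := (convex_Icc (0 : ℝ) s).norm_image_sub_le_of_norm_hasDerivWithin_le
    (f := fun t => p.eval t) (fun t _ => (p.hasDerivAt t).hasDerivWithinAt) hder
    (Set.left_mem_Icc.2 hs) (Set.right_mem_Icc.2 hs)
  simpa [abs_of_nonneg hs] using this

/-- The function `g` restricts on every line to a polynomial of degree at most `k`. -/
def IsPolyOnLines {E : Type*} [AddCommGroup E] [Module ℝ E] (k : ℕ) (g : E → ℝ) : Prop :=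
  ∀ a b : E, ∃ q : Polynomial ℝ, q.natDegree ≤ k ∧ ∀ t : ℝ, g (a + t • b) = q.eval t

section

variable {E : Type*} [NormedAddCommGroup E] [InnerProductSpace ℝ E]

lemma IsPolyOnLines.abs_sub_le {k : ℕ} {g : E → ℝ} (hg : IsPolyOnLines k g) {s L A : ℝ}
    {B : Set E} (hB : Convex ℝ B) (hA : 0 < A) (hb : ∀ z ∈ B, |g z| ≤ A) {x e : E}
    (hx : x ∈ B) (hL : x + L • e ∈ B) (hs : 0 < s) (hsL : (3 * (k : ℝ) ^ 2 + 1) * s ≤ L) :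
    |g (x + s • e) - g x| ≤ 2 / 3 * A := by
  obtain ⟨q, hq, hqe⟩ := hg x e
  have hk : 0 ≤ (k : ℝ) ^ 2 * s := by positivity
  by_cases hk0 : k = 0
  · subst hk0
    have h0 := hqe 0
    rw [zero_smul, add_zero] at h0
    rw [hqe, h0, Polynomial.eq_C_of_natDegree_le_zero hq]
    simp only [Polynomial.eval_C, sub_self, abs_zero]
    positivity
  have hk1 : (1 : ℝ) ≤ (k : ℝ) ^ 2 := by
    have : (1 : ℝ) ≤ k := by exact_mod_cast Nat.one_le_iff_ne_zero.2 hk0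
    nlinarith
  have hsL' : s < L := by nlinarith
  have hL0 : 0 < L := hs.trans hsL'
  have h := abs_eval_sub_eval_zero_le hq hA hs.le hsL' (fun t ht => by
    rw [← hqe]
    apply hb
    have := hB hx hL (a := 1 - t / L) (b := t / L)
      (by rw [sub_nonneg, div_le_one hL0]; exact ht.2) (div_nonneg ht.1 hL0.le) (by ring)
    convert this using 1
    rw [smul_add, smul_smul, div_mul_cancel₀ _ hL0.ne', ← add_assoc, ← add_smul]
    simp)
  have h0 := hqe 0
  rw [zero_smul, add_zero] at h0
  rw [hqe, h0]
  refine h.trans ?_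
  rw [mul_right_comm]
  refine mul_le_mul_of_nonneg_right ?_ hA.le
  rw [div_mul_eq_mul_div, div_le_iff₀ (by linarith)]
  nlinarith

/-- Scattered points which are `h`-dense in a ball of radius `9 k² h` form a norming set, with
constant `3`, for the polynomials of degree `k` on that ball. From a maximum point of `|g|` one
moves towards the centre of the ball, where there is room for a long segment through a nearby data
point, and the endpoint Markov inequality on the segment bounds the loss. -/
lemma IsPolyOnLines.abs_le_of_scattered [ProperSpace E] {k : ℕ} (hk : 1 ≤ k) {g : E → ℝ}
    (hg : IsPolyOnLines k g) (hc : Continuous g) {h : ℝ} (hh : 0 < h) {y : E} {Z : Set E}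
    (hZ : ∀ w ∈ Metric.closedBall y (9 * (k : ℝ) ^ 2 * h), ∃ z ∈ Z, ‖w - z‖ ≤ h) {A : ℝ}
    (hA : ∀ z ∈ Z, z ∈ Metric.closedBall y (9 * (k : ℝ) ^ 2 * h) → |g z| ≤ A) (hA0 : 0 ≤ A) :
    ∀ x ∈ Metric.closedBall y (9 * (k : ℝ) ^ 2 * h), |g x| ≤ 3 * A := by
  have hk1 : (1 : ℝ) ≤ (k : ℝ) ^ 2 := by
    have : (1 : ℝ) ≤ k := by exact_mod_cast hk
    nlinarith
  set R : ℝ := 9 * (k : ℝ) ^ 2 * h with hR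
  have hRh : 9 * h ≤ R := by rw [hR]; nlinarith
  have hR0 : 0 < R := by linarith
  obtain ⟨x, hx, hmax⟩ := (isCompact_closedBall y R).exists_isMaxOn
    ⟨y, Metric.mem_closedBall_self hR0.le⟩ (f := fun x => |g x|) (by fun_prop)
  have hmax' : ∀ z ∈ Metric.closedBall y R, |g z| ≤ |g x| := fun z hz => hmax hz
  suffices hx3 : |g x| ≤ 3 * A from fun z hz => (hmax' z hz).trans hx3
  rcases (abs_nonneg (g x)).eq_or_lt with h0 | h0
  · rw [← h0]; positivity
  -- it is enough to lose at most two thirds of the maximum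
  suffices hz : ∃ z ∈ Z, z ∈ Metric.closedBall y R ∧ |g z - g x| ≤ 2 / 3 * |g x| by
    obtain ⟨z, hzZ, hzB, hz⟩ := hz
    have h1 := hA z hzZ hzB
    have h2 : |g x| ≤ |g z| + |g z - g x| := by
      rw [← abs_neg (g z - g x)]
      calc |g x| = |g z + -(g z - g x)| := by ring_nf
        _ ≤ _ := abs_add_le _ _
    linarith
  have main : ∀ z : E, ∀ L : ℝ, z ≠ x → x + (L / ‖z - x‖) • (z - x) ∈ Metric.closedBall y R →
      (3 * (k : ℝ) ^ 2 + 1) * ‖z - x‖ ≤ L →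
      z ∈ Metric.closedBall y R ∧ |g z - g x| ≤ 2 / 3 * |g x| := by
    intro z L hzx hL hsL
    have hs : 0 < ‖z - x‖ := norm_pos_iff.2 (sub_ne_zero.2 hzx)
    have hz : z = x + (1 : ℝ) • (z - x) := by simp
    constructor
    · have hLs : 1 ≤ L / ‖z - x‖ := by rw [one_le_div hs]; nlinarith
      have := (convex_closedBall y R).add_smul_sub_mem hx hL (t := (L / ‖z - x‖)⁻¹)
        ⟨by positivity, inv_le_one_of_one_le₀ hLs⟩
      rw [add_sub_cancel_left, smul_smul, inv_mul_cancel₀ (by positivity), ← hz] at this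
      exact this
    · have := hg.abs_sub_le (convex_closedBall y R) h0 hmax' hx (e := ‖z - x‖⁻¹ • (z - x))
        (s := ‖z - x‖) (L := L) (by rw [smul_smul, ← div_eq_mul_inv]; exact hL) hs hsL
      rwa [smul_smul, mul_inv_cancel₀ hs.ne', ← hz] at this
  rw [Metric.mem_closedBall, dist_eq_norm] at hx
  rcases le_total ‖x - y‖ (R / 2) with hcase | hcase
  · obtain ⟨z, hzZ, hz⟩ := hZ x (by rw [Metric.mem_closedBall, dist_eq_norm]; exact hx)
    by_cases hzx : z = x
    · refine ⟨x, hzx ▸ hzZ, by rwa [Metric.mem_closedBall, dist_eq_norm], ?_⟩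
      simp only [sub_self, abs_zero]; positivity
    have hs : 0 < ‖z - x‖ := norm_pos_iff.2 (sub_ne_zero.2 hzx)
    rw [norm_sub_rev] at hz
    refine ⟨z, hzZ, main z (R / 2) hzx ?_ ?_⟩
    · rw [Metric.mem_closedBall, dist_eq_norm]
      calc ‖x + (R / 2 / ‖z - x‖) • (z - x) - y‖
          = ‖(x - y) + (R / 2 / ‖z - x‖) • (z - x)‖ := by congr 1; abel
        _ ≤ ‖x - y‖ + ‖(R / 2 / ‖z - x‖) • (z - x)‖ := norm_add_le _ _
        _ = ‖x - y‖ + R / 2 := by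
          rw [norm_smul, Real.norm_of_nonneg (by positivity), div_mul_cancel₀ _ hs.ne']
        _ ≤ R := by linarith
    · calc (3 * (k : ℝ) ^ 2 + 1) * ‖z - x‖ ≤ (3 * (k : ℝ) ^ 2 + 1) * h := by gcongr
        _ ≤ R / 2 := by rw [hR]; nlinarith
  · set ρ := ‖x - y‖ with hρ
    have hρ0 : 0 < ρ := by linarith
    set e₀ : E := ρ⁻¹ • (y - x) with he₀
    have he₀n : ‖e₀‖ = 1 := by
      rw [he₀, norm_smul, norm_sub_rev, Real.norm_of_nonneg (by positivity),
        inv_mul_cancel₀ hρ0.ne']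
    have hye : y - x = ρ • e₀ := by rw [he₀, smul_smul, mul_inv_cancel₀ hρ0.ne', one_smul]
    obtain ⟨z, hzZ, hz⟩ := hZ (x + (2 * h) • e₀) (by
      rw [Metric.mem_closedBall, dist_eq_norm]
      have : x + (2 * h) • e₀ - y = (2 * h - ρ) • e₀ := by
        rw [sub_smul, ← hye]; abel
      rw [this, norm_smul, he₀n, mul_one, Real.norm_eq_abs, abs_le]
      constructor <;> linarith)
    set q := z - (x + (2 * h) • e₀) with hq
    have hqn : ‖q‖ ≤ h := by rw [hq, norm_sub_rev]; exact hz
    have hzx' : z - x = (2 * h) • e₀ + q := by rw [hq]; abel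
    set a := inner ℝ q e₀ with ha
    have haq : |a| ≤ h := by
      have := abs_real_inner_le_norm q e₀
      rw [he₀n, mul_one] at this
      exact this.trans hqn
    obtain ⟨ha1, ha2⟩ := abs_le.1 haq
    have hin : inner ℝ (z - x) e₀ = 2 * h + a := by
      rw [hzx', inner_add_left, inner_smul_left, real_inner_self_eq_norm_sq, he₀n]
      simp [ha]
    have hnsq : ‖z - x‖ ^ 2 ≤ 5 * h ^ 2 + 4 * h * a := by
      rw [hzx', norm_add_sq_real, norm_smul, he₀n, inner_smul_left, real_inner_comm, ← ha,
        Real.norm_of_nonneg (by positivity)]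
      have : ‖q‖ ^ 2 ≤ h ^ 2 := by gcongr
      simp only [conj_trivial]
      nlinarith
    have hs3 : ‖z - x‖ ≤ 3 * h := by
      refine abs_le_of_sq_le_sq' ?_ (by positivity) |>.2
      nlinarith
    have hs0 : z ≠ x := by
      intro hzx
      rw [hzx, sub_self, inner_zero_left] at hin
      linarith
    have hs : 0 < ‖z - x‖ := norm_pos_iff.2 (sub_ne_zero.2 hs0)
    refine ⟨z, hzZ, main z (4 / 3 * R) hs0 ?_ ?_⟩
    · rw [Metric.mem_closedBall, dist_eq_norm]
      set s := ‖z - x‖ with hsdef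
      -- the angle between `z - x` and `y - x` is at most `30°`, and `0.866 < √3 / 2`
      have hcos : 0.866 * s ≤ 2 * h + a := by
        refine abs_le_of_sq_le_sq' ?_ (by linarith) |>.2
        nlinarith [sq_nonneg (h / 2 + a), sq_nonneg s]
      have hexp : x + (4 / 3 * R / s) • (z - x) - y = (4 / 3 * R / s) • (z - x) - ρ • e₀ := by
        rw [← hye]; abel
      refine abs_le_of_sq_le_sq' ?_ hR0.le |>.2
      rw [hexp, norm_sub_sq_real, norm_smul, norm_smul, he₀n, inner_smul_left, inner_smul_right,
        hin, Real.norm_of_nonneg (by positivity), Real.norm_of_nonneg hρ0.le, ← hsdef,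
        div_mul_cancel₀ _ hs.ne']
      have h1 : 4 / 3 * R * 0.866 ≤ 4 / 3 * R / s * (2 * h + a) := by
        rw [div_mul_eq_mul_div _ s, mul_div_assoc (4 / 3 * R)]
        exact mul_le_mul_of_nonneg_left ((le_div_iff₀ hs).2 hcos) (by positivity)
      have h2 : 4 / 3 * R * 0.866 * ρ ≤ 4 / 3 * R / s * (2 * h + a) * ρ := by gcongr
      simp only [conj_trivial, mul_one]
      have h3 : 0 ≤ (R - ρ) * (ρ - R / 2) := mul_nonneg (by linarith) (by linarith)
      nlinarith
    · calc (3 * (k : ℝ) ^ 2 + 1) * ‖z - x‖ ≤ (3 * (k : ℝ) ^ 2 + 1) * (3 * h) := by gcongr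
        _ ≤ 4 / 3 * R := by rw [hR]; nlinarith

end

open Polynomial in
/-- A multilinear form of degree `j` restricted to the diagonal of a line is a polynomial of degree
at most `j` in the parameter. -/
lemma exists_polynomial_multilinear_eval_line {E : Type*} [AddCommGroup E] [Module ℝ E] :
    ∀ (j : ℕ) (F : MultilinearMap ℝ (fun _ : Fin j => E) ℝ) (a b : E),
      ∃ q : ℝ[X], q.natDegree ≤ j ∧ ∀ t : ℝ, F (fun _ => a + t • b) = q.eval t
  | 0, F, a, b => ⟨C (F ![]), by simp, fun t => by
      rw [eval_C]; congr 1; exact Subsingleton.elim _ _⟩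
  | j + 1, F, a, b => by
    obtain ⟨q₁, hd₁, h₁⟩ := exists_polynomial_multilinear_eval_line j (F.curryLeft a) a b
    obtain ⟨q₂, hd₂, h₂⟩ := exists_polynomial_multilinear_eval_line j (F.curryLeft b) a b
    refine ⟨q₁ + X * q₂, ?_, fun t => ?_⟩
    · refine natDegree_add_le_of_degree_le (by omega) (natDegree_mul_le.trans ?_)
      have := natDegree_X_le (R := ℝ)
      omega
    · have : (fun _ : Fin (j + 1) => a + t • b) =
          Fin.cons (a + t • b) (fun _ : Fin j => a + t • b) := by
        ext i; refine Fin.cases ?_ (fun i => ?_) i <;> simp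
      rw [this, ← MultilinearMap.curryLeft_apply, map_add, map_smul, add_apply,
        smul_apply, h₁, h₂]
      simp

/-- The Taylor polynomial of `u` at `x₀` of degree at most `k`. -/
def taylorPoly {E : Type*} [NormedAddCommGroup E] [NormedSpace ℝ E] (u : E → ℝ) (k : ℕ)
    (x₀ x : E) : ℝ :=
  ∑ j ∈ Finset.range (k + 1), ((j.factorial : ℝ)⁻¹) • iteratedFDeriv ℝ j u x₀ (fun _ => x - x₀)

lemma isPolyOnLines_taylorPoly {E : Type*} [NormedAddCommGroup E] [NormedSpace ℝ E] (u : E → ℝ)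
    (k : ℕ) (x₀ : E) : IsPolyOnLines k (taylorPoly u k x₀) := by
  intro a b
  choose q hq hqe using fun j => exists_polynomial_multilinear_eval_line j
    (iteratedFDeriv ℝ j u x₀).toMultilinearMap (a - x₀) b
  refine ⟨∑ j ∈ Finset.range (k + 1), ((j.factorial : ℝ)⁻¹) • q j, ?_, fun t => ?_⟩
  · refine Polynomial.natDegree_sum_le_of_forall_le _ _ fun j hj => ?_
    refine (Polynomial.natDegree_smul_le _ _).trans ((hq j).trans ?_)
    have := Finset.mem_range.1 hj
    omega
  · rw [taylorPoly, Polynomial.eval_finsetSum]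
    refine Finset.sum_congr rfl fun j _ => ?_
    rw [Polynomial.eval_smul, ← hqe]
    simp only [ContinuousMultilinearMap.coe_coe, add_sub_right_comm]

lemma continuous_taylorPoly {E : Type*} [NormedAddCommGroup E] [NormedSpace ℝ E] (u : E → ℝ)
    (k : ℕ) (x₀ : E) : Continuous (taylorPoly u k x₀) := by
  refine continuous_finsetSum _ fun j _ => ?_
  exact continuous_const.mul ((iteratedFDeriv ℝ j u x₀).cont.comp
    (by fun_prop : Continuous fun x => fun _ => x - x₀))

lemma sum_abs_coord_le {d : ℕ} (v : Eucl d) : ∑ i, |v i| ≤ √(d : ℝ) * ‖v‖ := by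
  have h := Finset.sum_mul_sq_le_sq_mul_sq Finset.univ (fun _ : Fin d => (1 : ℝ)) (fun i => |v i|)
  simp only [one_mul, one_pow, Finset.sum_const, Finset.card_univ, Fintype.card_fin,
    nsmul_eq_mul, mul_one, sq_abs] at h
  refine abs_le_of_sq_le_sq' ?_ (by positivity) |>.2
  rw [mul_pow, Real.sq_sqrt (by positivity), EuclideanSpace.norm_sq_eq]
  simpa using h

lemma abs_multilinear_diag_le {d j : ℕ}
    (F : ContinuousMultilinearMap ℝ (fun _ : Fin j => Eucl d) ℝ) {K : ℝ}
    (hK : ∀ I : Fin j → Fin d, |F fun a => EuclideanSpace.single (I a) (1 : ℝ)| ≤ K)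
    (v : Eucl d) : |F fun _ => v| ≤ K * (∑ i, |v i|) ^ j := by
  have hv : v = ∑ i, v i • EuclideanSpace.single i (1 : ℝ) := by
    ext l
    simp [Pi.single_apply]
  have h1 : (F fun _ => v) = ∑ I : Fin j → Fin d,
      (∏ a, v (I a)) * F fun a => EuclideanSpace.single (I a) (1 : ℝ) := by
    conv_lhs => rw [hv]
    rw [F.map_sum]
    refine Finset.sum_congr rfl fun I _ => ?_
    rw [F.map_smul_univ, smul_eq_mul]
  rw [h1, Fintype.sum_pow, Finset.mul_sum]
  refine (Finset.abs_sum_le_sum_abs _ _).trans (Finset.sum_le_sum fun I _ => ?_)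
  rw [abs_mul, Finset.abs_prod, mul_comm]
  exact mul_le_mul_of_nonneg_right (hK I) (Finset.prod_nonneg fun _ _ => abs_nonneg _)

/-- Taylor's theorem along the segment from `x₀` to `x`; the coordinatewise bound `K` on the
derivatives turns into a bound with the `ℓ¹` norm of `x - x₀`, hence the factor `√d`. -/
lemma abs_sub_taylorPoly_le {d k : ℕ} {Ω : Set (Eucl d)} (hΩ : IsOpen Ω) {u : Eucl d → ℝ}
    (hu : ContDiffOn ℝ (k + 1 : ℕ) u Ω) {K : ℝ} (hK0 : 0 ≤ K)
    (hK : ∀ (I : Fin (k + 1) → Fin d), ∀ x ∈ Ω, |partialDeriv I u x| ≤ K) {x₀ x : Eucl d}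
    (hseg : segment ℝ x₀ x ⊆ Ω) :
    |u x - taylorPoly u k x₀ x| ≤
      K * (√(d : ℝ) * ‖x - x₀‖) ^ (k + 1) / ((k + 1).factorial : ℝ) := by
  have hmem : ∀ t ∈ Set.Icc (0 : ℝ) 1, x₀ + t • (x - x₀) ∈ Ω := fun t ht =>
    hseg (by rw [segment_eq_image']; exact ⟨t, ht, rfl⟩)
  have hT := map_add_eq_sum_add_integral_iteratedFDeriv (f := u) (x := x₀) (y := x - x₀) (n := k)
    (fun t ht => by
      have := hu.contDiffAt (hΩ.mem_nhds (hmem t ht))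
      exact_mod_cast this)
  rw [add_sub_cancel] at hT
  set c := K * (√(d : ℝ) * ‖x - x₀‖) ^ (k + 1) with hc
  rw [hT, taylorPoly, add_sub_cancel_left, smul_eq_mul, abs_mul,
    abs_of_pos (by positivity : (0 : ℝ) < (k.factorial : ℝ)⁻¹)]
  have hbound : ‖∫ t in (0 : ℝ)..1, (1 - t) ^ k •
      iteratedFDeriv ℝ (k + 1) u (x₀ + t • (x - x₀)) (fun _ => x - x₀)‖
      ≤ ∫ t in (0 : ℝ)..1, (1 - t) ^ k * c := by
    refine intervalIntegral.norm_integral_le_of_norm_le zero_le_one ?_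
      (Continuous.intervalIntegrable (by fun_prop) _ _)
    refine Filter.Eventually.of_forall fun t ht => ?_
    have ht' : 0 ≤ 1 - t := by linarith [ht.2]
    rw [smul_eq_mul, norm_mul, Real.norm_of_nonneg (by positivity)]
    refine mul_le_mul_of_nonneg_left ?_ (by positivity)
    refine (abs_multilinear_diag_le _ (fun I => hK I _ (hmem t ⟨ht.1.le, ht.2⟩)) _).trans ?_
    rw [hc]
    exact mul_le_mul_of_nonneg_left (pow_le_pow_left₀ (Finset.sum_nonneg fun _ _ => abs_nonneg _)
      (sum_abs_coord_le _) _) hK0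
  have hint : ∫ t in (0 : ℝ)..1, (1 - t) ^ k * c = c / (k + 1) := by
    rw [intervalIntegral.integral_mul_const,
      intervalIntegral.integral_comp_sub_left (fun t => t ^ k) 1]
    simp [integral_pow]
    ring
  rw [hint] at hbound
  calc _ ≤ (k.factorial : ℝ)⁻¹ * (c / (k + 1)) := by
        refine mul_le_mul_of_nonneg_left hbound (by positivity)
    _ = c / ((k + 1).factorial : ℝ) := by
        rw [Nat.factorial_succ]; push_cast; field_simp

lemma IsUnionOfBalls.isOpen {d : ℕ} {Ω : Set (Eucl d)} {r : ℝ} (h : IsUnionOfBalls Ω r) :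
    IsOpen Ω := by
  obtain ⟨-, S, -, rfl⟩ := h
  exact isOpen_biUnion fun _ _ => Metric.isOpen_ball

lemma IsUnionOfBalls.isBounded {d : ℕ} {Ω : Set (Eucl d)} {r : ℝ} (h : IsUnionOfBalls Ω r) :
    Bornology.IsBounded Ω := by
  obtain ⟨-, S, hS, rfl⟩ := h
  refine (hS.cthickening (δ := r)).subset ?_
  refine Set.iUnion₂_subset fun x hx y hy => ?_
  exact Metric.mem_cthickening_of_dist_le y x r S hx (Metric.mem_ball.1 hy).le

lemma IsUnionOfBalls.exists_ball {d : ℕ} {Ω : Set (Eucl d)} {r : ℝ} (h : IsUnionOfBalls Ω r)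
    {x : Eucl d} (hx : x ∈ Ω) : ∃ s, x ∈ Metric.ball s r ∧ Metric.ball s r ⊆ Ω := by
  obtain ⟨-, S, -, rfl⟩ := h
  obtain ⟨s, hs, hxs⟩ := Set.mem_iUnion₂.1 hx
  exact ⟨s, hxs, Set.subset_biUnion_of_mem (u := fun x => Metric.ball x r) hs⟩

lemma exists_norm_sub_le_fillDistance {d n : ℕ} (hn : 1 ≤ n) {Ω : Set (Eucl d)}
    (hΩ : Bornology.IsBounded Ω) (X : Fin n → Ω) {x : Eucl d} (hx : x ∈ Ω) :
    ∃ i, ‖x - X i‖ ≤ fillDistance Ω X := by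
  have : Nonempty (Fin n) := ⟨⟨0, hn⟩⟩
  obtain ⟨i, hi⟩ := exists_eq_ciInf_of_finite (f := fun i => ‖x - X i‖)
  obtain ⟨C, hC⟩ := Metric.isBounded_iff.1 hΩ
  refine ⟨i, hi.le.trans ?_⟩
  refine le_ciSup (f := fun x : Ω => ⨅ i, ‖(x : Eucl d) - X i‖) ⟨C, ?_⟩ ⟨x, hx⟩
  rintro _ ⟨y, rfl⟩
  refine (ciInf_le ⟨0, ?_⟩ ⟨0, hn⟩).trans ?_
  · rintro _ ⟨i, rfl⟩; positivity
  · rw [← dist_eq_norm]; exact hC y.2 (X _).2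

/-- Functions with scattered zeros: if `u` vanishes at the data points and its derivatives of order
`m` are bounded by `K`, then `|u| ≤ η K` on the domain. On a ball of radius `9 (m - 1)² h` close to
the given point, `u` is replaced by its Taylor polynomial, which is small at the data points and
hence everywhere, because these form a norming set. -/
theorem abs_le_eta_mul {d n : ℕ} (hd : 1 ≤ d) (hn : 1 ≤ n) {Ω : Set (Eucl d)} {r : ℝ}
    (hΩ : IsUnionOfBalls Ω r) (X : Fin n → Ω) {m : ℕ} (hm : 2 ≤ m)
    (hfill : fillDistance Ω X ≤ r / (18 * ((m : ℝ) - 1) ^ 2)) {u : Eucl d → ℝ}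
    (hu : ContDiffOn ℝ m u Ω) (hX : ∀ i, u (X i) = 0) {K : ℝ}
    (hK : ∀ (I : Fin m → Fin d), ∀ x ∈ Ω, |partialDeriv I u x| ≤ K) :
    ∀ x ∈ Ω, |u x| ≤ eta Ω X m * K := by
  intro x₀ hx₀
  obtain ⟨k, rfl⟩ : ∃ k, m = k + 1 := ⟨m - 1, by omega⟩
  have hk : 1 ≤ k := by omega
  have hopen := hΩ.isOpen
  have hK0 : 0 ≤ K := (abs_nonneg _).trans (hK (fun _ => ⟨0, hd⟩) x₀ hx₀)
  set h := fillDistance Ω X with hdef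
  have hnear : ∀ w ∈ Ω, ∃ i, ‖w - X i‖ ≤ h := fun w hw =>
    exists_norm_sub_le_fillDistance hn hΩ.isBounded X hw
  have hh0 : 0 ≤ h := by
    obtain ⟨i, hi⟩ := hnear x₀ hx₀
    exact (norm_nonneg _).trans hi
  have hkm : ((k + 1 : ℕ) : ℝ) - 1 = k := by push_cast; ring
  have heta : eta Ω X (k + 1) * K =
      3 * (K * (d * (18 * (k : ℝ) ^ 2 * h)) ^ (k + 1) / ((k + 1).factorial : ℝ)) := by
    rw [eta, hkm, pow_mul, mul_pow _ (k : ℝ) 2, mul_pow 3 _ 2, Real.sq_sqrt (by positivity), ← hdef]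
    have : (d * (18 * (k : ℝ) ^ 2 * h)) ^ (k + 1) =
        ((3 : ℝ) ^ 2 * (2 * d) * (k : ℝ) ^ 2) ^ (k + 1) * h ^ (k + 1) := by
      rw [← mul_pow]; ring_nf
    rw [this]; ring
  rw [heta]
  rcases hh0.eq_or_lt with h0 | hpos
  · obtain ⟨i, hi⟩ := hnear x₀ hx₀
    rw [← h0] at hi
    have : x₀ = X i := sub_eq_zero.1 (norm_le_zero_iff.1 hi)
    rw [this, hX, abs_zero]
    positivity
  have hk0 : (0 : ℝ) < (k : ℝ) ^ 2 := by positivity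
  have hr : 0 < r := hΩ.1
  obtain ⟨s, hxs, hballΩ⟩ := hΩ.exists_ball hx₀
  rw [hkm, le_div_iff₀ (by positivity)] at hfill
  set R := 9 * (k : ℝ) ^ 2 * h with hR
  have hR0 : 0 < R := by positivity
  have hRr : R < r := by rw [hR]; nlinarith
  rw [Metric.mem_ball, dist_eq_norm] at hxs
  -- a closed ball of radius `R` inside the open ball of radius `r`, containing `x₀`
  set y := s + (1 - R / r) • (x₀ - s) with hy
  have hRr1 : R / r < 1 := (div_lt_one hr).2 hRr
  have hyB : Metric.closedBall y R ⊆ Metric.ball s r := by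
    intro z hz
    rw [Metric.mem_closedBall] at hz
    rw [Metric.mem_ball]
    have hys : dist y s < r - R := by
      rw [dist_eq_norm, hy, add_sub_cancel_left, norm_smul, Real.norm_of_nonneg (by linarith)]
      calc (1 - R / r) * ‖x₀ - s‖ < (1 - R / r) * r := by
            refine mul_lt_mul_of_pos_left hxs (by linarith)
        _ = r - R := by field_simp
    linarith [dist_triangle z y s]
  have hx₀B : x₀ ∈ Metric.closedBall y R := by
    rw [Metric.mem_closedBall, dist_eq_norm]
    have : x₀ - y = (R / r) • (x₀ - s) := by rw [hy, sub_smul, one_smul]; abel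
    rw [this, norm_smul, Real.norm_of_nonneg (by positivity)]
    calc R / r * ‖x₀ - s‖ ≤ R / r * r := by gcongr
      _ = R := div_mul_cancel₀ _ hr.ne'
  have hself : taylorPoly u k x₀ x₀ = u x₀ := by
    rw [taylorPoly, Finset.sum_eq_single 0]
    · simp
    · intro j _ hj
      rw [sub_self, ContinuousMultilinearMap.map_coord_zero _ (⟨0, by omega⟩ : Fin j) rfl,
        smul_zero]
    · simp
  have hE : ∀ z ∈ Set.range (fun i => (X i : Eucl d)), z ∈ Metric.closedBall y R →
      |taylorPoly u k x₀ z| ≤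
        K * (d * (18 * (k : ℝ) ^ 2 * h)) ^ (k + 1) / ((k + 1).factorial : ℝ) := by
    rintro _ ⟨i, rfl⟩ hz
    have h1 := abs_sub_taylorPoly_le hopen hu hK0 hK (x₀ := x₀) (x := X i)
      (((convex_closedBall y R).segment_subset hx₀B hz).trans (hyB.trans hballΩ))
    rw [hX, zero_sub, abs_neg] at h1
    refine h1.trans ?_
    have h2 : ‖(X i : Eucl d) - x₀‖ ≤ 18 * (k : ℝ) ^ 2 * h := by
      rw [← dist_eq_norm]
      have := dist_triangle_right (X i : Eucl d) x₀ y
      rw [Metric.mem_closedBall] at hz hx₀B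
      rw [hR] at hz hx₀B
      linarith
    have h3 : √(d : ℝ) ≤ d := by
      have : (1 : ℝ) ≤ d := by exact_mod_cast hd
      rw [Real.sqrt_le_left (by positivity)]
      nlinarith
    gcongr
  have := (isPolyOnLines_taylorPoly u k x₀).abs_le_of_scattered hk (continuous_taylorPoly u k x₀)
    hpos (y := y) (Z := Set.range fun i => (X i : Eucl d)) (fun w hw => by
      obtain ⟨i, hi⟩ := hnear w (hballΩ (hyB hw))
      exact ⟨_, ⟨i, rfl⟩, hi⟩) hE (by positivity) x₀ hx₀B
  rwa [hself] at this

end Sampling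

/-! ### Iterated finite differences -/

section FiniteDifferences

variable {E F G : Type*} [NormedAddCommGroup E] [NormedAddCommGroup F] [NormedAddCommGroup G]

/-- The iterated finite difference of `g` at `x` with increments `v 0, …, v (n - 1)`. -/
def fdiff : (n : ℕ) → (Fin n → E) → (E → F) → E → F
  | 0, _, g => g
  | n + 1, v, g => fdiff n (Fin.tail v) fun y => g (y + v 0) - g y

lemma map_fdiff [NormedSpace ℝ F] [NormedSpace ℝ G] (L : F →L[ℝ] G) :
    ∀ (n : ℕ) (v : Fin n → E) (g : E → F) (x : E),
    L (fdiff n v g x) = fdiff n v (fun y => L (g y)) x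
  | 0, _, _, _ => rfl
  | n + 1, v, g, x => by simp only [fdiff, map_fdiff L n, map_sub]

lemma mem_ball_shift {x y w : E} {ρ : ℝ} (hy : y ∈ Metric.ball x (ρ - ‖w‖)) :
    y + w ∈ Metric.ball x ρ ∧ y ∈ Metric.ball x ρ := by
  rw [Metric.mem_ball, dist_eq_norm] at *
  have := norm_nonneg w
  refine ⟨?_, by rw [Metric.mem_ball, dist_eq_norm]; linarith⟩
  calc ‖y + w - x‖ = ‖(y - x) + w‖ := by congr 1; abel
    _ ≤ ‖y - x‖ + ‖w‖ := norm_add_le _ _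
    _ < ρ := by linarith

lemma fdiff_congr : ∀ (n : ℕ) (v : Fin n → E) (g g' : E → F) (x : E) (ρ : ℝ),
    ∑ a, ‖v a‖ < ρ → Set.EqOn g g' (Metric.ball x ρ) → fdiff n v g x = fdiff n v g' x
  | 0, _, _, _, x, ρ, hρ, h => h (Metric.mem_ball_self (by simpa using hρ))
  | n + 1, v, g, g', x, ρ, hρ, h => by
    rw [Fin.sum_univ_succ] at hρ
    refine fdiff_congr n (Fin.tail v) _ _ x (ρ - ‖v 0‖) (lt_sub_iff_add_lt'.2 hρ) fun y hy => ?_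
    have := mem_ball_shift hy
    simp only [h this.1, h this.2]

/-- Mean value theorem for iterated finite differences. -/
lemma exists_fdiff_eq_iteratedFDeriv [NormedSpace ℝ E] :
    ∀ (n : ℕ) (v : Fin n → E) (g : E → ℝ) (x : E) (ρ : ℝ),
    ∑ a, ‖v a‖ < ρ → ContDiffOn ℝ n g (Metric.ball x ρ) →
      ∃ x', ‖x' - x‖ ≤ ∑ a, ‖v a‖ ∧ fdiff n v g x = iteratedFDeriv ℝ n g x' v
  | 0, v, g, x, ρ, _, _ => ⟨x, by simp, by simp [fdiff]⟩
  | n + 1, v, g, x, ρ, hρ, hg => by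
    rw [Fin.sum_univ_succ] at hρ ⊢
    have hgn : ContDiffOn ℝ n g (Metric.ball x ρ) := hg.of_le (by exact_mod_cast n.le_succ)
    have hshift : ContDiffOn ℝ n (fun y => g (y + v 0)) (Metric.ball x (ρ - ‖v 0‖)) :=
      hgn.comp (contDiff_id.add contDiff_const).contDiffOn fun y hy => (mem_ball_shift hy).1
    have hρ' : ∑ a, ‖Fin.tail v a‖ < ρ - ‖v 0‖ := lt_sub_iff_add_lt'.2 hρ
    obtain ⟨x', hx', h'⟩ := exists_fdiff_eq_iteratedFDeriv n (Fin.tail v)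
      (fun y => g (y + v 0) - g y) x (ρ - ‖v 0‖) hρ'
      (hshift.sub (hgn.mono fun y hy => (mem_ball_shift hy).2))
    have hx'B : x' ∈ Metric.ball x (ρ - ‖v 0‖) := by
      rw [Metric.mem_ball, dist_eq_norm]; exact hx'.trans_lt hρ'
    have hseg : ∀ s ∈ Set.Icc (0 : ℝ) 1, x' + s • v 0 ∈ Metric.ball x ρ := fun s hs =>
      (convex_ball x ρ).add_smul_mem (mem_ball_shift hx'B).2 (mem_ball_shift hx'B).1 hs
    have hder : ∀ s ∈ Set.Icc (0 : ℝ) 1,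
        HasDerivAt (fun s : ℝ => iteratedFDeriv ℝ n g (x' + s • v 0) (Fin.tail v))
          (iteratedFDeriv ℝ (n + 1) g (x' + s • v 0) v) s := by
      intro s hs
      have hd : DifferentiableAt ℝ (iteratedFDeriv ℝ n g) (x' + s • v 0) :=
        (hg.contDiffAt (Metric.isOpen_ball.mem_nhds (hseg s hs))).differentiableAt_iteratedFDeriv
          (by exact_mod_cast n.lt_succ_self)
      have hline : HasDerivAt (fun s : ℝ => x' + s • v 0) (v 0) s := by
        simpa using ((hasDerivAt_id s).smul_const (v 0)).const_add x'
      have h1 := hd.hasFDerivAt.comp_hasDerivAt s hline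
      have h2 := (ContinuousMultilinearMap.apply ℝ (fun _ : Fin n => E) ℝ
        (Fin.tail v)).hasFDerivAt.comp_hasDerivAt s h1
      simpa [iteratedFDeriv_succ_apply_left, Function.comp_def] using h2
    obtain ⟨s, hs, hsl⟩ := exists_hasDerivAt_eq_slope _ _ zero_lt_one
      (fun s hs => (hder s hs).continuousAt.continuousWithinAt)
      (fun s hs => hder s ⟨hs.1.le, hs.2.le⟩)
    refine ⟨x' + s • v 0, ?_, ?_⟩
    · calc ‖x' + s • v 0 - x‖ = ‖(x' - x) + s • v 0‖ := by congr 1; abel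
        _ ≤ ‖x' - x‖ + ‖s • v 0‖ := norm_add_le _ _
        _ ≤ (∑ a, ‖Fin.tail v a‖) + 1 * ‖v 0‖ := by
          rw [norm_smul, Real.norm_of_nonneg hs.1.le]
          gcongr
          exact hs.2.le
        _ = _ := by rw [one_mul, add_comm]; rfl
    · rw [fdiff, h', hsl]
      have e1 : ContDiffAt ℝ n (fun y => g (y + v 0)) x' :=
        hshift.contDiffAt (Metric.isOpen_ball.mem_nhds hx'B)
      have e2 : ContDiffAt ℝ n g x' :=
        hgn.contDiffAt (Metric.isOpen_ball.mem_nhds (mem_ball_shift hx'B).2)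
      rw [fun_iteratedFDeriv_sub_apply e1 e2, iteratedFDeriv_comp_add_right]
      simp

/-- Finite differences in a parameter commute with differentiation. -/
lemma iteratedFDeriv_fdiff [NormedSpace ℝ G] {n : ℕ} {U : Set G} (hU : IsOpen U) :
    ∀ (i : ℕ) (v : Fin i → E) (k : E → G → ℝ) (x : E) (ρ : ℝ), ∑ a, ‖v a‖ < ρ →
      (∀ x' ∈ Metric.ball x ρ, ContDiffOn ℝ n (k x') U) →
      ContDiffOn ℝ n (fun y => fdiff i v (fun x' => k x' y) x) U ∧
      ∀ y ∈ U, ∀ w : Fin n → G, iteratedFDeriv ℝ n (fun y => fdiff i v (fun x' => k x' y) x) y w =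
        fdiff i v (fun x' => iteratedFDeriv ℝ n (k x') y w) x
  | 0, _, k, x, ρ, hρ, h => ⟨h x (Metric.mem_ball_self (by simpa using hρ)), fun _ _ _ => rfl⟩
  | i + 1, v, k, x, ρ, hρ, h => by
    rw [Fin.sum_univ_succ] at hρ
    have hρ' : ∑ a, ‖Fin.tail v a‖ < ρ - ‖v 0‖ := lt_sub_iff_add_lt'.2 hρ
    obtain ⟨h1, h2⟩ := iteratedFDeriv_fdiff hU i (Fin.tail v) (fun x' y => k (x' + v 0) y - k x' y)
      x (ρ - ‖v 0‖) hρ'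
      (fun x' hx' => (h _ (mem_ball_shift hx').1).sub (h _ (mem_ball_shift hx').2))
    refine ⟨h1, fun y hy w => ?_⟩
    refine (h2 y hy w).trans ?_
    refine fdiff_congr i _ _ _ x (ρ - ‖v 0‖) hρ' fun x' hx' => ?_
    have e1 := (h _ (mem_ball_shift hx').1).contDiffAt (hU.mem_nhds hy)
    have e2 := (h _ (mem_ball_shift hx').2).contDiffAt (hU.mem_nhds hy)
    simp only
    rw [fun_iteratedFDeriv_sub_apply e1 e2]
    rfl

end FiniteDifferences

/-! ### Differentiability of the feature map -/

section Feature

variable {d : ℕ} {Ω : Set (Eucl d)} (H : Type*) [NormedAddCommGroup H] [InnerProductSpace ℝ H]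
  [CompleteSpace H] [RKHS ℝ H Ω ℝ]

/-- The feature map, extended by zero outside `Ω`. -/
def featureExt : Eucl d → H :=
  open Classical in fun x => if h : x ∈ Ω then feature H ⟨x, h⟩ else 0

variable {H}

lemma inner_feature_right (u : H) (x : Ω) : inner ℝ u (feature H x) = u x := by
  rw [feature, RKHS.inner_kerFun]
  simp

lemma inner_feature_left (u : H) (x : Ω) : inner ℝ (feature H x) u = u x := by
  rw [real_inner_comm, inner_feature_right]

lemma featureExt_of_mem {x : Eucl d} (hx : x ∈ Ω) : featureExt H x = feature H ⟨x, hx⟩ :=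
  dif_pos hx

lemma extendZero_eq_inner (u : H) (x : Eucl d) :
    extendZero (fun y : Ω => u y) x = inner ℝ u (featureExt H x) := by
  by_cases h : x ∈ Ω
  · simp [extendZero, featureExt, h, inner_feature_right]
  · simp [extendZero, featureExt, h]

lemma kerExt_eq_inner (x y : Eucl d) :
    kerExt H x y = inner ℝ (featureExt H x) (featureExt H y) := by
  by_cases hx : x ∈ Ω <;> by_cases hy : y ∈ Ω <;>
    simp [kerExt, extendZero, featureExt, hx, hy, ker_eq_inner]

lemma eq_of_inner_feature {u v : H} (h : ∀ x ∈ Ω, inner ℝ (featureExt H x) u =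
    inner ℝ (featureExt H x) v) : u = v := by
  refine RKHS.ext fun x => ?_
  have := h x x.2
  rwa [featureExt_of_mem x.2, inner_feature_left, inner_feature_left] at this

variable (H) in
/-- The normalized iterated difference of the feature map at `x`, with step `1 / (n + 1)` in the
coordinate directions `I`. -/
def featureQuot {i : ℕ} (I : Fin i → Fin d) (x : Eucl d) (n : ℕ) : H :=
  ((1 / ((n : ℝ) + 1)) ^ i)⁻¹ • fdiff i
    (fun a => (1 / ((n : ℝ) + 1)) • EuclideanSpace.single (I a) (1 : ℝ)) (featureExt H) x

lemma sum_norm_smul_single {i : ℕ} (I : Fin i → Fin d) {t : ℝ} (ht : 0 ≤ t) :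
    ∑ a, ‖t • EuclideanSpace.single (I a) (1 : ℝ)‖ = i * t := by
  simp [norm_smul, abs_of_nonneg ht]

/-- The inner product of two difference quotients of the feature map is a mixed derivative of the
kernel at nearby points. Taking the differences in `y` first, then those in `x`, matches the order
of differentiation in `kerDeriv`, so that no interchange of derivatives is needed. -/
lemma exists_inner_featureQuot {m : ℕ} (hk : KernelContDiff H m) {i j : ℕ} (hi : i ≤ m)
    (hj : j ≤ m) (I : Fin i → Fin d) (J : Fin j → Fin d) {x y : Eucl d} {ρ : ℝ}
    (hx : Metric.ball x ρ ⊆ Ω) (hy : Metric.ball y ρ ⊆ Ω) (hΩ : IsOpen Ω) {p q : ℕ}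
    (hp : i * (1 / ((p : ℝ) + 1)) < ρ) (hq : j * (1 / ((q : ℝ) + 1)) < ρ) :
    ∃ x' y', ‖x' - x‖ ≤ i * (1 / ((p : ℝ) + 1)) ∧ ‖y' - y‖ ≤ j * (1 / ((q : ℝ) + 1)) ∧
      inner ℝ (featureQuot H I x p) (featureQuot H J y q) = kerDeriv H I J x' y' := by
  set t : ℝ := 1 / ((p : ℝ) + 1) with ht
  set s : ℝ := 1 / ((q : ℝ) + 1) with hs
  have ht0 : 0 < t := by positivity
  have hs0 : 0 < s := by positivity
  set v : Fin i → Eucl d := fun a => t • EuclideanSpace.single (I a) (1 : ℝ) with hv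
  set w : Fin j → Eucl d := fun a => s • EuclideanSpace.single (J a) (1 : ℝ) with hw
  have hvs : ∑ a, ‖v a‖ = i * t := sum_norm_smul_single I ht0.le
  have hws : ∑ a, ‖w a‖ = j * s := sum_norm_smul_single J hs0.le
  have hright : ∀ x' ∈ Metric.ball x ρ, ContDiffOn ℝ j (kerExt H x') Ω := fun x' hx' =>
    (hk.right x' (hx hx')).of_le (by exact_mod_cast hj)
  obtain ⟨hY1, hY2⟩ := iteratedFDeriv_fdiff hΩ i v (kerExt H) x ρ (by rwa [hvs]) hright
  obtain ⟨y', hy', e1⟩ := exists_fdiff_eq_iteratedFDeriv j w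
    (fun y => fdiff i v (fun x' => kerExt H x' y) x) y ρ (by rwa [hws]) (hY1.mono hy)
  rw [hws] at hy'
  have hy'Ω : y' ∈ Ω := hy (by rw [Metric.mem_ball, dist_eq_norm]; exact hy'.trans_lt hq)
  rw [hY2 y' hy'Ω] at e1
  have e2 : (fun x' => iteratedFDeriv ℝ j (kerExt H x') y' w) =
      fun x' => (s ^ j • ContinuousLinearMap.id ℝ ℝ)
        (partialDeriv J (fun y' => kerExt H x' y') y') := by
    funext x'
    rw [hw, ContinuousMultilinearMap.map_smul_univ]
    simp [partialDeriv]
  rw [e2, ← map_fdiff] at e1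
  obtain ⟨x', hx', e3⟩ := exists_fdiff_eq_iteratedFDeriv i v
    (fun x' => partialDeriv J (fun y' => kerExt H x' y') y') x ρ (by rwa [hvs])
    (((hk.left j hj J y' hy'Ω).of_le (by exact_mod_cast hi)).mono hx)
  rw [hvs] at hx'
  refine ⟨x', y', hx', hy', ?_⟩
  have e4 : iteratedFDeriv ℝ i (fun x' => partialDeriv J (fun y' => kerExt H x' y') y') x' v =
      t ^ i * kerDeriv H I J x' y' := by
    rw [hv, ContinuousMultilinearMap.map_smul_univ]
    simp [partialDeriv, kerDeriv]
  have e5 : inner ℝ (fdiff i v (featureExt H) x) (fdiff j w (featureExt H) y) =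
      fdiff j w (fun y => fdiff i v (fun x' => kerExt H x' y) x) y := by
    rw [← innerSL_apply_apply ℝ, map_fdiff]
    congr 1
    funext y
    rw [innerSL_apply_apply, real_inner_comm, ← innerSL_apply_apply ℝ, map_fdiff]
    congr 1
    funext x'
    rw [innerSL_apply_apply, real_inner_comm, kerExt_eq_inner]
  rw [featureQuot, featureQuot, ← ht, ← hs, ← hv, ← hw, inner_smul_left, inner_smul_right, e5, e1,
    e3, e4]
  simp only [conj_trivial, FunLike.coe_smul, Pi.smul_apply, ContinuousLinearMap.id_apply,
    smul_eq_mul]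
  field_simp

variable (H) in
/-- The derivative `∂^I φ` of the feature map, as the limit of difference quotients. The limit exists
for `x ∈ Ω` and orders up to `m` (`tendsto_featureQuot`); elsewhere the value is arbitrary. -/
def featureDeriv {i : ℕ} (I : Fin i → Fin d) (x : Eucl d) : H :=
  Filter.limUnder Filter.atTop (featureQuot H I x)

lemma tendsto_inner_featureQuot {m : ℕ} (hk : KernelContDiff H m) (hΩ : IsOpen Ω) {i j : ℕ}
    (hi : i ≤ m) (hj : j ≤ m) (I : Fin i → Fin d) (J : Fin j → Fin d) {x y : Eucl d} (hx : x ∈ Ω)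
    (hy : y ∈ Ω) :
    Filter.Tendsto (fun p : ℕ × ℕ => inner ℝ (featureQuot H I x p.1) (featureQuot H J y p.2))
      Filter.atTop (nhds (kerDeriv H I J x y)) := by
  obtain ⟨ρ₁, hρ₁, hb₁⟩ := Metric.isOpen_iff.1 hΩ x hx
  obtain ⟨ρ₂, hρ₂, hb₂⟩ := Metric.isOpen_iff.1 hΩ y hy
  have hcont : ContinuousAt (fun p : Eucl d × Eucl d => kerDeriv H I J p.1 p.2) (x, y) :=
    (hk.joint i hi j hj I J).continuousAt ((hΩ.prod hΩ).mem_nhds ⟨hx, hy⟩)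
  rw [Metric.tendsto_nhds]
  intro ε hε
  obtain ⟨δ, hδ, hδε⟩ := Metric.continuousAt_iff.1 hcont ε hε
  have hlim : ∀ i : ℕ, Filter.Tendsto (fun p : ℕ => (i : ℝ) * (1 / ((p : ℝ) + 1))) Filter.atTop
      (nhds 0) := fun i => by
    simpa using (tendsto_one_div_add_atTop_nhds_zero_nat (𝕜 := ℝ)).const_mul (i : ℝ)
  set ρ := min ρ₁ ρ₂
  have hρ : 0 < min ρ δ := lt_min (lt_min hρ₁ hρ₂) hδ
  have h1 := (hlim i).eventually (gt_mem_nhds hρ)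
  have h2 := (hlim j).eventually (gt_mem_nhds hρ)
  rw [← Filter.prod_atTop_atTop_eq]
  filter_upwards [h1.prod_mk h2] with p hp
  obtain ⟨x', y', hx', hy', he⟩ := exists_inner_featureQuot hk hi hj I J
    ((Metric.ball_subset_ball (min_le_left _ _)).trans hb₁)
    ((Metric.ball_subset_ball (min_le_right _ _)).trans hb₂) hΩ
    (hp.1.trans_le (min_le_left _ _)) (hp.2.trans_le (min_le_left _ _))
  rw [he]
  refine hδε (x := (x', y')) ?_
  rw [Prod.dist_eq, max_lt_iff, dist_eq_norm, dist_eq_norm]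
  exact ⟨hx'.trans_lt (hp.1.trans_le (min_le_right _ _)),
    hy'.trans_lt (hp.2.trans_le (min_le_right _ _))⟩

lemma tendsto_featureQuot {m : ℕ} (hk : KernelContDiff H m) (hΩ : IsOpen Ω) {i : ℕ}
    (hi : i ≤ m) (I : Fin i → Fin d) {x : Eucl d} (hx : x ∈ Ω) :
    Filter.Tendsto (featureQuot H I x) Filter.atTop (nhds (featureDeriv H I x)) := by
  refine CauchySeq.tendsto_limUnder ?_
  have h := tendsto_inner_featureQuot hk hΩ hi hi I I hx hx
  rw [Metric.cauchySeq_iff]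
  intro ε hε
  have h1 := Metric.tendsto_nhds.1 h (ε ^ 2 / 4) (by positivity)
  rw [Filter.eventually_atTop] at h1
  obtain ⟨⟨a, b⟩, hab⟩ := h1
  refine ⟨max a b, fun p hp q hq => ?_⟩
  have key : ∀ p q : ℕ, max a b ≤ p → max a b ≤ q → |inner ℝ (featureQuot H I x p)
      (featureQuot H I x q) - kerDeriv H I I x x| < ε ^ 2 / 4 := fun p q hp hq =>
    hab (p, q) ⟨(le_max_left _ _).trans hp, (le_max_right _ _).trans hq⟩
  have k1 := abs_lt.1 (key p p hp hp)
  have k2 := abs_lt.1 (key p q hp hq)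
  have k3 := abs_lt.1 (key q q hq hq)
  rw [dist_eq_norm]
  refine lt_of_pow_lt_pow_left₀ 2 hε.le ?_
  rw [norm_sub_sq_real, ← real_inner_self_eq_norm_sq, ← real_inner_self_eq_norm_sq]
  linarith [k1.2, k2.1, k3.2]

/-- The derivatives of the feature map reproduce the mixed derivatives of the kernel. -/
lemma inner_featureDeriv {m : ℕ} (hk : KernelContDiff H m) (hΩ : IsOpen Ω) {i j : ℕ}
    (hi : i ≤ m) (hj : j ≤ m) (I : Fin i → Fin d) (J : Fin j → Fin d) {x y : Eucl d} (hx : x ∈ Ω)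
    (hy : y ∈ Ω) : inner ℝ (featureDeriv H I x) (featureDeriv H J y) = kerDeriv H I J x y := by
  have h1 := (tendsto_featureQuot hk hΩ hi I hx).inner (𝕜 := ℝ) (tendsto_featureQuot hk hΩ hj J hy)
  have h2 := (tendsto_inner_featureQuot hk hΩ hi hj I J hx hy).comp
    (Filter.tendsto_id.prodMk Filter.tendsto_id |>.mono_right Filter.prod_atTop_atTop_eq.le)
  exact tendsto_nhds_unique h1 h2

lemma featureDeriv_zero (I : Fin 0 → Fin d) (x : Eucl d) :
    featureDeriv H I x = featureExt H x := by
  refine Filter.Tendsto.limUnder_eq ?_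
  have : featureQuot H I x = fun _ => featureExt H x := by
    funext n
    simp [featureQuot, fdiff]
  rw [this]
  exact tendsto_const_nhds

lemma inner_featureExt_featureDeriv {m : ℕ} (hk : KernelContDiff H m) (hΩ : IsOpen Ω) {i : ℕ}
    (hi : i ≤ m) (I : Fin i → Fin d) {x y : Eucl d} (hx : x ∈ Ω) (hy : y ∈ Ω) :
    inner ℝ (featureExt H x) (featureDeriv H I y) = partialDeriv I (kerExt H x) y := by
  rw [← featureDeriv_zero (fun a => a.elim0), inner_featureDeriv hk hΩ (Nat.zero_le m) hi _ _ hx hy]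
  simp only [kerDeriv]
  rw [partialDeriv, iteratedFDeriv_zero_apply]

lemma continuousOn_featureDeriv {m : ℕ} (hk : KernelContDiff H m) (hΩ : IsOpen Ω) {i : ℕ}
    (hi : i ≤ m) (I : Fin i → Fin d) : ContinuousOn (featureDeriv H I) Ω := by
  intro x hx
  have hj := hk.joint i hi i hi I I
  have e : ∀ y ∈ Ω, ‖featureDeriv H I y - featureDeriv H I x‖ ^ 2 =
      kerDeriv H I I y y - 2 * kerDeriv H I I y x + kerDeriv H I I x x := fun y hy => by
    rw [norm_sub_sq_real, ← real_inner_self_eq_norm_sq, ← real_inner_self_eq_norm_sq,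
      inner_featureDeriv hk hΩ hi hi I I hy hy, inner_featureDeriv hk hΩ hi hi I I hy hx,
      inner_featureDeriv hk hΩ hi hi I I hx hx]
  have c1 : ContinuousWithinAt (fun y => kerDeriv H I I y y) Ω x :=
    (hj (x, x) ⟨hx, hx⟩).comp (f := fun y => (y, y)) (t := Ω ×ˢ Ω) (by fun_prop)
      fun y hy => ⟨hy, hy⟩
  have c2 : ContinuousWithinAt (fun y => kerDeriv H I I y x) Ω x :=
    (hj (x, x) ⟨hx, hx⟩).comp (f := fun y => (y, x)) (t := Ω ×ˢ Ω) (by fun_prop)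
      fun y hy => ⟨hy, hx⟩
  have h3 : Filter.Tendsto (fun y => ‖featureDeriv H I y - featureDeriv H I x‖ ^ 2)
      (nhdsWithin x Ω) (nhds 0) := by
    have := Filter.Tendsto.add_const (kerDeriv H I I x x)
      (Filter.Tendsto.sub c1 (Filter.Tendsto.const_mul 2 c2))
    rw [show kerDeriv H I I x x - 2 * kerDeriv H I I x x + kerDeriv H I I x x = 0 by ring] at this
    refine this.congr' ?_
    filter_upwards [self_mem_nhdsWithin] with y hy
    rw [e y hy]
  rw [ContinuousWithinAt, tendsto_iff_norm_sub_tendsto_zero]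
  have h4 := h3.sqrt
  simpa using h4

/-- If the increments of `F` near `x` are line integrals of `L`, and `L` is continuous, then `L x`
is the derivative of `F` at `x`. -/
lemma hasFDerivAt_of_eq_integral {E G : Type*} [NormedAddCommGroup E] [NormedSpace ℝ E]
    [NormedAddCommGroup G] [NormedSpace ℝ G] [CompleteSpace G] {F : E → G} {L : E → E →L[ℝ] G}
    {x : E} {ρ : ℝ} (hρ : 0 < ρ) (hL : ContinuousOn L (Metric.ball x ρ))
    (hF : ∀ v : E, ‖v‖ < ρ → F (x + v) - F x = ∫ s in (0 : ℝ)..1, L (x + s • v) v) :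
    HasFDerivAt F (L x) x := by
  have hLx : ContinuousAt L x := hL.continuousAt (Metric.ball_mem_nhds x hρ)
  rw [hasFDerivAt_iff_isLittleO_nhds_zero, Asymptotics.isLittleO_iff]
  intro ε hε
  obtain ⟨δ, hδ, hδε⟩ := Metric.continuousAt_iff.1 hLx ε hε
  filter_upwards [Metric.ball_mem_nhds (0 : E) (lt_min hρ hδ)] with v hv
  rw [mem_ball_zero_iff, lt_min_iff] at hv
  have hsv : ∀ s ∈ Set.uIcc (0 : ℝ) 1, ‖s • v‖ ≤ ‖v‖ := fun s hs => by
    rw [Set.uIcc_of_le zero_le_one] at hs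
    rw [norm_smul, Real.norm_of_nonneg hs.1]
    exact mul_le_of_le_one_left (norm_nonneg v) hs.2
  have hint : IntervalIntegrable (fun s : ℝ => L (x + s • v) v) MeasureTheory.volume 0 1 := by
    refine ContinuousOn.intervalIntegrable ?_
    refine ContinuousOn.clm_apply (hL.comp (by fun_prop) fun s hs => ?_) continuousOn_const
    rw [Metric.mem_ball, dist_eq_norm, add_sub_cancel_left]
    exact (hsv s hs).trans_lt hv.1
  have : F (x + v) - F x - L x v = ∫ s in (0 : ℝ)..1, (L (x + s • v) v - L x v) := by
    rw [intervalIntegral.integral_sub hint (by simp), hF v hv.1]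
    simp
  rw [this]
  have hb := intervalIntegral.norm_integral_le_of_norm_le_const (a := (0 : ℝ)) (b := 1)
    (C := ε * ‖v‖) (f := fun s : ℝ => L (x + s • v) v - L x v) (fun s hs => by
      rw [← sub_apply]
      refine (ContinuousLinearMap.le_opNorm _ _).trans ?_
      refine mul_le_mul_of_nonneg_right ?_ (norm_nonneg v)
      rw [← dist_eq_norm]
      refine (hδε ?_).le
      rw [dist_eq_norm, add_sub_cancel_left]
      exact (hsv s (Set.uIoc_subset_uIcc hs)).trans_lt hv.2)
  simpa using hb

lemma hasDerivAt_partialDeriv_line {m i : ℕ} (hi : i + 1 ≤ m) (hΩ : IsOpen Ω) {g : Eucl d → ℝ}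
    (hg : ContDiffOn ℝ m g Ω) (I : Fin i → Fin d) {x v : Eucl d} {s : ℝ} (hs : x + s • v ∈ Ω) :
    HasDerivAt (fun s : ℝ => partialDeriv I g (x + s • v))
      (∑ l, v l * partialDeriv (Fin.cons l I : Fin (i + 1) → Fin d) g (x + s • v)) s := by
  have hd : DifferentiableAt ℝ (iteratedFDeriv ℝ i g) (x + s • v) :=
    (hg.contDiffAt (hΩ.mem_nhds hs)).differentiableAt_iteratedFDeriv (by exact_mod_cast hi)
  have hline : HasDerivAt (fun s : ℝ => x + s • v) v s := by
    simpa using ((hasDerivAt_id s).smul_const v).const_add x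
  have h2 := (ContinuousMultilinearMap.apply ℝ (fun _ : Fin i => Eucl d) ℝ
    (fun a => EuclideanSpace.single (I a) (1 : ℝ))).hasFDerivAt.comp_hasDerivAt s
    (hd.hasFDerivAt.comp_hasDerivAt s hline)
  have hv : v = ∑ l, v l • EuclideanSpace.single l (1 : ℝ) := by
    ext l
    simp [Pi.single_apply]
  refine h2.congr_deriv ?_
  have hL : ∀ T : Eucl d →L[ℝ] ℝ, T v = ∑ l, v l * T (EuclideanSpace.single l (1 : ℝ)) := by
    intro T
    conv_lhs => rw [hv]
    simp only [map_sum, map_smul, smul_eq_mul]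
  refine (hL ((ContinuousMultilinearMap.apply ℝ (fun _ : Fin i => Eucl d) ℝ
    (fun a => EuclideanSpace.single (I a) (1 : ℝ))).comp
      (fderiv ℝ (iteratedFDeriv ℝ i g) (x + s • v)))).trans ?_
  refine Finset.sum_congr rfl fun l _ => ?_
  rw [partialDeriv, iteratedFDeriv_succ_apply_left]
  rfl

/-- The candidate for the Fréchet derivative of `∂^I φ`: the sum over the coordinates `l` of the
`l`-th coordinate functional times `∂_l ∂^I φ`. -/
def featureFDeriv {i : ℕ} (I : Fin i → Fin d) (x : Eucl d) : Eucl d →L[ℝ] H :=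
  ∑ l, (EuclideanSpace.proj l : Eucl d →L[ℝ] ℝ).smulRight
    (featureDeriv H (Fin.cons l I : Fin (i + 1) → Fin d) x)

lemma hasFDerivAt_featureDeriv {m : ℕ} (hk : KernelContDiff H m) (hΩ : IsOpen Ω) {i : ℕ}
    (hi : i + 1 ≤ m) (I : Fin i → Fin d) {x : Eucl d} (hx : x ∈ Ω) :
    HasFDerivAt (featureDeriv H I) (featureFDeriv I x) x := by
  obtain ⟨ρ, hρ, hb⟩ := Metric.isOpen_iff.1 hΩ x hx
  have hLc : ContinuousOn (featureFDeriv (H := H) I) (Metric.ball x ρ) := by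
    refine continuousOn_finsetSum _ fun l _ => ?_
    have hc := (continuousOn_featureDeriv hk hΩ hi (Fin.cons l I : Fin (i + 1) → Fin d)).mono hb
    exact (ContinuousLinearMap.smulRightL ℝ (Eucl d) H
      (EuclideanSpace.proj l)).continuous.comp_continuousOn hc
  refine hasFDerivAt_of_eq_integral hρ hLc fun v hv => ?_
  have hmem : ∀ s ∈ Set.uIcc (0 : ℝ) 1, x + s • v ∈ Metric.ball x ρ := fun s hs => by
    rw [Set.uIcc_of_le zero_le_one] at hs
    rw [Metric.mem_ball, dist_eq_norm, add_sub_cancel_left, norm_smul, Real.norm_of_nonneg hs.1]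
    exact (mul_le_of_le_one_left (norm_nonneg v) hs.2).trans_lt hv
  have hint : ContinuousOn (fun s : ℝ => featureFDeriv (H := H) I (x + s • v) v)
      (Set.uIcc 0 1) :=
    ContinuousOn.clm_apply (hLc.comp (by fun_prop) hmem) continuousOn_const
  -- both sides are compared as functions on `Ω`
  refine eq_of_inner_feature fun x' hx' => ?_
  have hg := hk.right x' hx'
  have e : ∀ s ∈ Set.uIcc (0 : ℝ) 1,
      inner ℝ (featureExt H x') (featureFDeriv (H := H) I (x + s • v) v) =
      ∑ l, v l * partialDeriv (Fin.cons l I : Fin (i + 1) → Fin d) (kerExt H x') (x + s • v) := by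
    intro s hs
    simp only [featureFDeriv, FunLike.coe_sum, Finset.sum_apply,
      ContinuousLinearMap.smulRight_apply, inner_sum, inner_smul_right]
    exact Finset.sum_congr rfl fun l _ => by
      rw [inner_featureExt_featureDeriv hk hΩ hi _ hx' (hb (hmem s hs))]; rfl
  have hintR : ∫ s in (0 : ℝ)..1, inner ℝ (featureExt H x') (featureFDeriv (H := H) I (x + s • v) v)
      = inner ℝ (featureExt H x') (∫ s in (0 : ℝ)..1, featureFDeriv (H := H) I (x + s • v) v) := by
    simpa using (innerSL ℝ (featureExt H x')).intervalIntegral_comp_comm hint.intervalIntegrable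
  have hxv : x + v ∈ Ω := by simpa using hb (hmem 1 (by simp))
  rw [← hintR, inner_sub_right, inner_featureExt_featureDeriv hk hΩ (by omega) _ hx' hxv,
    inner_featureExt_featureDeriv hk hΩ (by omega) _ hx' hx]
  have hF := intervalIntegral.integral_eq_sub_of_hasDerivAt (a := (0 : ℝ)) (b := 1)
    (f := fun s : ℝ => partialDeriv I (kerExt H x') (x + s • v))
    (f' := fun s => inner ℝ (featureExt H x') (featureFDeriv (H := H) I (x + s • v) v))
    (fun s hs => by
      rw [e s hs]
      exact hasDerivAt_partialDeriv_line hi hΩ hg I (hb (hmem s hs)))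
    (by
      refine ContinuousOn.intervalIntegrable ?_
      exact continuousOn_const.inner hint)
  rw [hF]
  simp

lemma contDiffOn_featureDeriv {m : ℕ} (hk : KernelContDiff H m) (hΩ : IsOpen Ω) :
    ∀ (n i : ℕ), i + n ≤ m → ∀ I : Fin i → Fin d, ContDiffOn ℝ n (featureDeriv H I) Ω
  | 0, i, hi, I => by
    simpa using continuousOn_featureDeriv hk hΩ hi I
  | n + 1, i, hi, I => by
    have hd : ∀ x ∈ Ω, HasFDerivAt (featureDeriv H I) (featureFDeriv I x) x := fun x hx =>
      hasFDerivAt_featureDeriv hk hΩ (by omega) I hx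
    rw [show ((n + 1 : ℕ) : WithTop ℕ∞) = (n : WithTop ℕ∞) + 1 by push_cast; rfl,
      contDiffOn_succ_iff_fderiv_of_isOpen hΩ]
    refine ⟨fun x hx => (hd x hx).differentiableAt.differentiableWithinAt, by simp, ?_⟩
    have h2 : ContDiffOn ℝ n (featureFDeriv (H := H) I) Ω := by
      refine ContDiffOn.sum fun l _ => ?_
      exact (ContinuousLinearMap.smulRightL ℝ (Eucl d) H (EuclideanSpace.proj l)).contDiff
        |>.comp_contDiffOn
        (contDiffOn_featureDeriv hk hΩ n (i + 1) (by omega) _)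
    exact h2.congr fun x hx => (hd x hx).fderiv

lemma contDiffOn_featureExt {m : ℕ} (hk : KernelContDiff H m) (hΩ : IsOpen Ω) :
    ContDiffOn ℝ m (featureExt H) Ω := by
  have := contDiffOn_featureDeriv hk hΩ m 0 (by omega) (fun a => a.elim0)
  exact this.congr fun y _ => (featureDeriv_zero _ y).symm

lemma iteratedFDeriv_featureExt {m : ℕ} (hk : KernelContDiff H m) (hΩ : IsOpen Ω) :
    ∀ (i : ℕ), i ≤ m → ∀ I : Fin i → Fin d, ∀ x ∈ Ω,
      iteratedFDeriv ℝ i (featureExt H) x (fun a => EuclideanSpace.single (I a) (1 : ℝ)) =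
        featureDeriv H I x
  | 0, _, I, x, _ => by rw [featureDeriv_zero, iteratedFDeriv_zero_apply]
  | i + 1, hi, I, x, hx => by
    have hφ := contDiffOn_featureExt hk hΩ
    have hd : DifferentiableAt ℝ (iteratedFDeriv ℝ i (featureExt H)) x :=
      (hφ.contDiffAt (hΩ.mem_nhds hx)).differentiableAt_iteratedFDeriv (by exact_mod_cast hi)
    have h1 := (ContinuousMultilinearMap.apply ℝ (fun _ : Fin i => Eucl d) H
      (fun a => EuclideanSpace.single (Fin.tail I a) (1 : ℝ))).hasFDerivAt.comp x hd.hasFDerivAt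
    have h2 : HasFDerivAt (featureDeriv H (Fin.tail I)) _ x := h1.congr_of_eventuallyEq (by
      filter_upwards [hΩ.mem_nhds hx] with y hy
      exact (iteratedFDeriv_featureExt hk hΩ i (by omega) (Fin.tail I) y hy).symm)
    have h3 := h2.unique (hasFDerivAt_featureDeriv hk hΩ hi (Fin.tail I) hx)
    have h4 := congrArg (fun T : Eucl d →L[ℝ] H => T (EuclideanSpace.single (I 0) (1 : ℝ))) h3
    rw [iteratedFDeriv_succ_apply_left]
    refine Eq.trans ?_ (h4.trans ?_)
    · rfl
    · simp [featureFDeriv, Fin.cons_self_tail]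

lemma contDiffOn_extendZero {m : ℕ} (hk : KernelContDiff H m) (hΩ : IsOpen Ω) (u : H) :
    ContDiffOn ℝ m (extendZero fun y : Ω => u y) Ω := by
  have : (extendZero fun y : Ω => u y) = fun x => innerSL ℝ u (featureExt H x) := by
    funext x; rw [extendZero_eq_inner]; rfl
  rw [this]
  exact (innerSL ℝ u).contDiff.comp_contDiffOn (contDiffOn_featureExt hk hΩ)

/-- The derivative reproducing property bounds the derivatives of order `m` of the elements of `H`
by their norm. -/
lemma abs_partialDeriv_extendZero_le {m : ℕ} (hk : KernelContDiff H m) (hΩ : IsOpen Ω) {D : ℝ}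
    (hD : 0 ≤ D) (hb : ∀ I : Fin m → Fin d, ∀ x ∈ Ω, ∀ y ∈ Ω, |kerDeriv H I I x y| ≤ D ^ 2)
    (u : H) (I : Fin m → Fin d) {x : Eucl d} (hx : x ∈ Ω) :
    |partialDeriv I (extendZero fun y : Ω => u y) x| ≤ D * ‖u‖ := by
  have : (extendZero fun y : Ω => u y) = innerSL ℝ u ∘ featureExt H := by
    funext x; rw [extendZero_eq_inner]; rfl
  rw [partialDeriv, this, ContinuousLinearMap.iteratedFDeriv_comp_left (innerSL ℝ u)
    ((contDiffOn_featureExt hk hΩ).contDiffAt (hΩ.mem_nhds hx)) le_rfl]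
  change |innerSL ℝ u (iteratedFDeriv ℝ m (featureExt H) x _)| ≤ _
  rw [iteratedFDeriv_featureExt hk hΩ m le_rfl I x hx, innerSL_apply_apply]
  refine (abs_real_inner_le_norm _ _).trans ?_
  rw [mul_comm]
  refine mul_le_mul_of_nonneg_right ?_ (norm_nonneg u)
  refine abs_le_of_sq_le_sq' ?_ hD |>.2
  rw [← real_inner_self_eq_norm_sq, inner_featureDeriv hk hΩ le_rfl le_rfl I I hx hx]
  exact (le_abs_self _).trans (hb I x hx x hx)

end Feature

/-! ### Finite sums of squares as positive operators -/

section FiniteRank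

variable {H : Type*} [NormedAddCommGroup H] [InnerProductSpace ℝ H]

/-- The operator `∑ i, w i ⊗ w i`. -/
def sumSquaresOp {N : ℕ} (w : Fin N → H) : H →L[ℝ] H :=
  ∑ i, InnerProductSpace.rankOne ℝ (w i) (w i)

lemma inner_sumSquaresOp {N : ℕ} (w : Fin N → H) (x : H) :
    inner ℝ x (sumSquaresOp w x) = ∑ i, inner ℝ x (w i) ^ 2 := by
  simp only [sumSquaresOp, FunLike.coe_sum, Finset.sum_apply, InnerProductSpace.rankOne_apply,
    inner_sum, inner_smul_right]
  exact Finset.sum_congr rfl fun i _ => by rw [real_inner_comm, sq]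

lemma isPositive_sumSquaresOp {N : ℕ} (w : Fin N → H) : (sumSquaresOp w).IsPositive := by
  rw [sumSquaresOp]
  refine Finset.sum_induction _ ContinuousLinearMap.IsPositive (fun _ _ h h' => h.add h')
    ContinuousLinearMap.isPositive_zero fun i _ => InnerProductSpace.isPositive_rankOne_self _

lemma rank_sumSquaresOp_le {N : ℕ} (w : Fin N → H) :
    LinearMap.rank (sumSquaresOp w : H →ₗ[ℝ] H) ≤ (N : ℕ) := by
  have hr : (sumSquaresOp w : H →ₗ[ℝ] H).range ≤ Submodule.span ℝ (Set.range w) := by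
    rintro _ ⟨x, rfl⟩
    simp only [sumSquaresOp, ContinuousLinearMap.coe_coe, FunLike.coe_sum, Finset.sum_apply,
      InnerProductSpace.rankOne_apply]
    exact Submodule.sum_mem _ fun i _ => Submodule.smul_mem _ _ (Submodule.subset_span ⟨i, rfl⟩)
  refine (Submodule.rank_mono hr).trans ((rank_span_le _).trans ?_)
  simpa using Cardinal.mk_range_le_lift (f := w)

lemma hasTrace_sumSquaresOp {N : ℕ} (w : Fin N → H) :
    HasTrace (sumSquaresOp w) (∑ i, ‖w i‖ ^ 2) := by
  intro s b
  simp only [inner_sumSquaresOp]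
  refine hasSum_sum fun i _ => ?_
  have := b.hasSum_inner_mul_inner (w i) (w i)
  rw [real_inner_self_eq_norm_sq] at this
  refine this.congr_fun ?_ |> fun h => h
  intro j
  rw [sq, real_inner_comm (w i)]

end FiniteRank

/-! ### Smooth local factorization of positive definite matrices -/

section SmoothSqrt

/-- A smooth function near a point has the same germ as a globally smooth function. -/
lemma exists_contDiff_eventuallyEq {V : Type*} [NormedAddCommGroup V] [NormedSpace ℝ V]
    [FiniteDimensional ℝ V] {a : V → ℝ} {y₀ : V} (h : ∀ᶠ y in nhds y₀, ContDiffAt ℝ ∞ a y) :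
    ∃ b : V → ℝ, ContDiff ℝ ∞ b ∧ b =ᶠ[nhds y₀] a := by
  obtain ⟨ε, hε, hball⟩ := Metric.eventually_nhds_iff_ball.1 h
  let χ : ContDiffBump y₀ := ⟨ε / 3, ε / 2, by positivity, by linarith⟩
  refine ⟨fun y => χ y * a y, contDiff_iff_contDiffAt.2 fun y => ?_, ?_⟩
  · by_cases hy : y ∈ Metric.ball y₀ ε
    · exact χ.contDiffAt.mul (hball y hy)
    · have : (fun y => χ y * a y) =ᶠ[nhds y] fun _ => 0 := by
        rw [Metric.mem_ball, not_lt] at hy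
        filter_upwards [Metric.isClosed_closedBall.isOpen_compl.mem_nhds
          (show y ∈ (Metric.closedBall y₀ (ε / 2))ᶜ by
            simp only [Set.mem_compl_iff, Metric.mem_closedBall, not_le]; linarith)] with z hz
        simp only [Set.mem_compl_iff, Metric.mem_closedBall, not_le] at hz
        rw [χ.zero_of_le_dist hz.le, zero_mul]
      exact contDiffAt_const.congr_of_eventuallyEq this
  · filter_upwards [χ.eventuallyEq_one] with y hy
    rw [hy, Pi.one_apply, one_mul]

/-- By the inverse function theorem the square map of a Banach algebra has a smooth local inverse
near `1`. By uniqueness it maps self-adjoint elements to self-adjoint elements. -/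
lemma exists_smooth_sqrt_near_one (𝔸 : Type*) [NormedRing 𝔸] [NormedAlgebra ℝ 𝔸] [CompleteSpace 𝔸]
    [StarRing 𝔸] [ContinuousStar 𝔸] :
    ∃ T : 𝔸 → 𝔸, (∀ᶠ P in nhds 1, ContDiffAt ℝ ∞ T P) ∧
      ∀ᶠ P in nhds (1 : 𝔸), IsSelfAdjoint P → IsSelfAdjoint (T P) ∧ T P * T P = P := by
  let f : 𝔸 → 𝔸 := fun S => S * S
  have hf : ContDiffAt ℝ ω f 1 := (contDiff_id.mul contDiff_id).contDiffAt
  let e : 𝔸 ≃L[ℝ] 𝔸 := ContinuousLinearEquiv.smulLeft (Units.mk0 (2 : ℝ) two_ne_zero)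
  have hf' : HasFDerivAt f (e : 𝔸 →L[ℝ] 𝔸) 1 := by
    have := (hasFDerivAt_id (𝕜 := ℝ) (1 : 𝔸)).mul' (hasFDerivAt_id (𝕜 := ℝ) (1 : 𝔸))
    refine this.congr_fderiv ?_
    ext x
    simp [e, two_smul, Units.smul_def]
  have hn : (ω : WithTop ℕ∞) ≠ 0 := by simp
  have hstrict := hf.hasStrictFDerivAt' hf' hn
  set T := hf.localInverse hf' hn with hT
  have hf1 : f 1 = 1 := by simp [f]
  have hT1 : T 1 = 1 := by
    have := hf.localInverse_apply_image hf' hn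
    rwa [hf1] at this
  have hTs : ContDiffAt ℝ ω T 1 := by
    have := hf.to_localInverse hf' hn
    rwa [hf1] at this
  have hright : ∀ᶠ P in nhds (1 : 𝔸), T P * T P = P := by
    have := hstrict.eventually_right_inverse
    rwa [hf1] at this
  have hleft : ∀ᶠ S in nhds (1 : 𝔸), T (S * S) = S := hstrict.eventually_left_inverse
  have hstar : Filter.Tendsto (fun P => star (T P)) (nhds (1 : 𝔸)) (nhds 1) := by
    have : ContinuousAt (fun P => star (T P)) 1 :=
      continuous_star.continuousAt.comp hTs.continuousAt
    rw [ContinuousAt, hT1, star_one] at this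
    exact this
  refine ⟨T, ?_, ?_⟩
  · filter_upwards [hTs.eventually (by simp)] with P hP
    exact hP.of_le le_top
  · filter_upwards [hright, hstar.eventually hleft] with P h1 h2 hP
    refine ⟨?_, h1⟩
    rw [← star_mul, h1, hP.star_eq] at h2
    exact h2.symm

/-- The vector of entries of a square matrix. -/
def vecOf {d : ℕ} (G : Matrix (Fin d) (Fin d) ℝ) : Eucl (d * d) :=
  WithLp.toLp 2 fun k => G (finProdFinEquiv.symm k).1 (finProdFinEquiv.symm k).2

/-- The square matrix with the given vector of entries. -/
def matOf {d : ℕ} (v : Eucl (d * d)) : Matrix (Fin d) (Fin d) ℝ :=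
  Matrix.of fun i j => v (finProdFinEquiv (i, j))

@[simp] lemma matOf_vecOf {d : ℕ} (G : Matrix (Fin d) (Fin d) ℝ) : matOf (vecOf G) = G := by
  ext i j
  change G (finProdFinEquiv.symm (finProdFinEquiv (i, j))).1
    (finProdFinEquiv.symm (finProdFinEquiv (i, j))).2 = G i j
  rw [Equiv.symm_apply_apply]

/-- Near a positive definite matrix, symmetric matrices factor as `Aᵀ A` with `A` depending
smoothly on the matrix. -/
lemma exists_smooth_factor {d : ℕ} {G₀ : Matrix (Fin d) (Fin d) ℝ} (hG : G₀.PosDef) :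
    ∃ a : Fin d → Fin d → Eucl (d * d) → ℝ, (∀ i j, ContDiff ℝ ∞ (a i j)) ∧
      ∀ᶠ v in nhds (vecOf G₀), (matOf v).IsSymm →
        matOf v = (Matrix.of fun i j => a i j v)ᵀ * Matrix.of fun i j => a i j v := by
  obtain ⟨B, hB, hGB⟩ : ∃ B : Matrix (Fin d) (Fin d) ℝ, IsUnit B ∧ G₀ = Bᴴ * B := by
    open scoped MatrixOrder in
    exact CStarAlgebra.isStrictlyPositive_iff_eq_star_mul_self.1
      (Matrix.isStrictlyPositive_iff_posDef.2 hG)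
  have hBdet : IsUnit B.det := (Matrix.isUnit_iff_isUnit_det B).1 hB
  have hBdet' : IsUnit Bᴴ.det := by rwa [Matrix.conjTranspose_eq_transpose_of_trivial,
    Matrix.det_transpose]
  obtain ⟨T, hTs, hT⟩ := exists_smooth_sqrt_near_one (Eucl d →L[ℝ] Eucl d)
  let N : Eucl (d * d) →ₗ[ℝ] (Eucl d →L[ℝ] Eucl d) :=
    { toFun := fun v => Matrix.toEuclideanCLM (𝕜 := ℝ) ((Bᴴ)⁻¹ * matOf v * B⁻¹)
      map_add' := fun v w => by
        rw [← map_add, ← add_mul, ← mul_add]; rfl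
      map_smul' := fun c v => by
        rw [RingHom.id_apply, ← map_smul, ← smul_mul_assoc, ← mul_smul_comm]; rfl }
  have hNc : Continuous N := N.continuous_of_finiteDimensional
  have hNs : ContDiff ℝ ∞ N := (LinearMap.toContinuousLinearMap N).contDiff
  have hN1 : N (vecOf G₀) = 1 := by
    change Matrix.toEuclideanCLM (𝕜 := ℝ) ((Bᴴ)⁻¹ * matOf (vecOf G₀) * B⁻¹) = 1
    rw [matOf_vecOf, hGB, Matrix.nonsing_inv_mul_cancel_left _ _ hBdet',
      Matrix.mul_nonsing_inv _ hBdet, map_one]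
  have hNt : Filter.Tendsto N (nhds (vecOf G₀)) (nhds 1) := by
    rw [← hN1]; exact hNc.continuousAt
  let S : Eucl (d * d) → Matrix (Fin d) (Fin d) ℝ := fun v =>
    (Matrix.toEuclideanCLM (𝕜 := ℝ)).symm (T (N v))
  let L : Fin d → Fin d → (Eucl d →L[ℝ] Eucl d) →ₗ[ℝ] ℝ := fun i j =>
    { toFun := fun A => ((Matrix.toEuclideanCLM (𝕜 := ℝ)).symm A * B) i j
      map_add' := fun A A' => by rw [map_add, add_mul]; rfl
      map_smul' := fun c A => by rw [map_smul, smul_mul_assoc]; rfl }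
  have hsm : ∀ i j, ∃ b : Eucl (d * d) → ℝ, ContDiff ℝ ∞ b ∧
      b =ᶠ[nhds (vecOf G₀)] fun v => (S v * B) i j := by
    intro i j
    refine exists_contDiff_eventuallyEq ?_
    filter_upwards [hNt.eventually hTs] with v hv
    exact (LinearMap.toContinuousLinearMap (L i j)).contDiff.contDiffAt.comp v
      (hv.comp v hNs.contDiffAt)
  choose a ha hae using hsm
  refine ⟨a, ha, ?_⟩
  have hall : ∀ᶠ v in nhds (vecOf G₀), ∀ i j, a i j v = (S v * B) i j := by
    rw [Filter.eventually_all]; intro i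
    rw [Filter.eventually_all]; exact fun j => hae i j
  filter_upwards [hall, hNt.eventually hT] with v hv hTv hsymm
  have hof : (Matrix.of fun i j => a i j v) = S v * B := by ext i j; exact hv i j
  have hsa : IsSelfAdjoint (N v) := by
    change IsSelfAdjoint (Matrix.toEuclideanCLM (𝕜 := ℝ) ((Bᴴ)⁻¹ * matOf v * B⁻¹))
    rw [IsSelfAdjoint, ← map_star]
    congr 1
    rw [Matrix.star_eq_conjTranspose, Matrix.conjTranspose_mul, Matrix.conjTranspose_mul,
      Matrix.conjTranspose_nonsing_inv, Matrix.conjTranspose_nonsing_inv,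
      Matrix.conjTranspose_conjTranspose, Matrix.conjTranspose_eq_transpose_of_trivial (matOf v),
      hsymm.eq, mul_assoc]
  obtain ⟨hTsa, hTT⟩ := hTv hsa
  have hSS : (S v)ᵀ * S v = (Bᴴ)⁻¹ * matOf v * B⁻¹ := by
    have h1 : (S v)ᵀ = S v := by
      rw [← Matrix.conjTranspose_eq_transpose_of_trivial, ← Matrix.star_eq_conjTranspose]
      refine EquivLike.injective (Matrix.toEuclideanCLM (𝕜 := ℝ) (n := Fin d)) ?_
      have hS : Matrix.toEuclideanCLM (𝕜 := ℝ) (S v) = T (N v) :=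
        (Matrix.toEuclideanCLM (𝕜 := ℝ) (n := Fin d)).apply_symm_apply _
      rw [map_star, hS, hTsa.star_eq]
    rw [h1]
    change (Matrix.toEuclideanCLM (𝕜 := ℝ)).symm (T (N v)) *
      (Matrix.toEuclideanCLM (𝕜 := ℝ)).symm (T (N v)) = _
    rw [← map_mul, hTT]
    exact (Matrix.toEuclideanCLM (𝕜 := ℝ)).symm_apply_apply _
  rw [hof, Matrix.transpose_mul, mul_assoc, ← mul_assoc (S v)ᵀ, hSS,
    ← Matrix.conjTranspose_eq_transpose_of_trivial, mul_assoc, mul_assoc,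
    Matrix.nonsing_inv_mul _ hBdet, mul_one, ← mul_assoc, Matrix.mul_nonsing_inv _ hBdet', one_mul]

/-- A smooth function which squares to the identity on `[δ, ∞)`. -/
lemma exists_smooth_real_sqrt {δ : ℝ} (hδ : 0 < δ) :
    ∃ s : ℝ → ℝ, ContDiff ℝ ∞ s ∧ ∀ t, δ ≤ t → s t ^ 2 = t := by
  refine ⟨fun t => √t * Real.smoothTransition (2 * t / δ - 1), ?_, fun t ht => ?_⟩
  · refine contDiff_iff_contDiffAt.2 fun t => ?_
    rcases lt_or_ge 0 t with h | h
    · exact (Real.contDiffAt_sqrt h.ne').mul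
        (Real.smoothTransition.contDiff.comp (by fun_prop)).contDiffAt
    · refine (contDiffAt_const (c := (0 : ℝ))).congr_of_eventuallyEq ?_
      filter_upwards [Iio_mem_nhds (show t < δ / 2 by linarith)] with u hu
      rw [Real.smoothTransition.zero_of_nonpos, mul_zero]
      rw [sub_nonpos, div_le_one hδ]
      linarith [Set.mem_Iio.1 hu]
  · have : (1 : ℝ) ≤ 2 * t / δ - 1 := by
      rw [le_sub_iff_add_le, le_div_iff₀ hδ]; linarith
    simp only
    rw [Real.smoothTransition.one_of_one_le this, mul_one, Real.sq_sqrt (by linarith)]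

end SmoothSqrt

/-! ### Exact sum-of-squares representation at the minimum -/

section Representation

variable {d : ℕ} {Ω : Set (Eucl d)} {H : Type*} [NormedAddCommGroup H] [InnerProductSpace ℝ H]
  [RKHS ℝ H Ω ℝ]

lemma extendZero_coe (u : Ω → ℝ) (x : Ω) : extendZero u (x : Eucl d) = u x := by
  simp [extendZero]

lemma restrictsTo_extendZero (u : H) : RestrictsTo H (extendZero fun y : Ω => u y) :=
  ⟨u, fun x => (extendZero_coe (fun y : Ω => u y) x).symm⟩

lemma RestrictsTo.add {u v : Eucl d → ℝ} (hu : RestrictsTo H u) (hv : RestrictsTo H v) :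
    RestrictsTo H fun x => u x + v x := by
  obtain ⟨g, hg⟩ := hu
  obtain ⟨g', hg'⟩ := hv
  exact ⟨g + g', fun x => by rw [RKHS.coe_add, Pi.add_apply, hg, hg']⟩

lemma RestrictsTo.sum {ι : Type*} (s : Finset ι) {u : ι → Eucl d → ℝ}
    (hu : ∀ i, RestrictsTo H (u i)) : RestrictsTo H fun x => ∑ i ∈ s, u i x := by
  classical
  induction s using Finset.induction_on with
  | empty => exact ⟨0, fun x => by simp⟩
  | insert a s ha ih =>
    simp only [Finset.sum_insert ha]
    exact (hu a).add ih

variable [CompleteSpace H] {m : ℕ} {M D : ℝ}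

lemma RestrictsTo.mul (hH : RichSpace H m M D) {u v : Eucl d → ℝ} (hu : RestrictsTo H u)
    (hv : RestrictsTo H v) : RestrictsTo H fun x => u x * v x := by
  obtain ⟨g, hg⟩ := hu
  obtain ⟨g', hg'⟩ := hv
  obtain ⟨p, hp, -⟩ := hH.mul_mem g g'
  exact ⟨p, fun x => by rw [hp, hg, hg']⟩

lemma RestrictsTo.comp (hH : RichSpace H m M D) {p : ℕ} {a : Eucl p → ℝ} (ha : ContDiff ℝ ∞ a)
    {v : Fin p → Eucl d → ℝ} (hv : ∀ i, RestrictsTo H (v i)) :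
    RestrictsTo H fun x => a (WithLp.toLp 2 fun i => v i x) := by
  choose g hg using hv
  obtain ⟨q, hq⟩ := hH.comp_mem p a ha g
  exact ⟨q, fun x => by rw [hq]; simp only [hg]⟩

lemma iteratedFDeriv_two_diag_eq_sum (f : Eucl d → ℝ) (x y : Eucl d) :
    iteratedFDeriv ℝ 2 f x (fun _ => y) = ∑ i, ∑ j, partialDeriv ![i, j] f x * (y i * y j) := by
  have hy : y = ∑ l, y l • EuclideanSpace.single l (1 : ℝ) := by
    ext l
    simp [Pi.single_apply]
  rw [iteratedFDeriv_two_apply]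
  conv_lhs => rw [hy]
  simp only [map_sum, map_smul, FunLike.coe_sum, Finset.sum_apply, FunLike.coe_smul, Pi.smul_apply,
    smul_eq_mul, Finset.mul_sum]
  rw [Finset.sum_comm]
  refine Finset.sum_congr rfl fun i _ => Finset.sum_congr rfl fun j _ => ?_
  rw [partialDeriv, iteratedFDeriv_two_apply]
  simp only [Matrix.cons_val_zero, Matrix.cons_val_one]
  ring

/-- The quadratic form of a symmetrized matrix. -/
lemma sum_symmetrize (G : Fin d → Fin d → ℝ) (y : Eucl d) :
    ∑ i, ∑ j, (1 / 2 * (G i j + G j i)) * (y i * y j) = ∑ i, ∑ j, G i j * (y i * y j) := by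
  have h : ∑ i, ∑ j, G j i * (y i * y j) = ∑ i, ∑ j, G i j * (y i * y j) := by
    rw [Finset.sum_comm]
    exact Finset.sum_congr rfl fun i _ => Finset.sum_congr rfl fun j _ => by ring
  calc _ = 1 / 2 * (∑ i, ∑ j, G i j * (y i * y j)) + 1 / 2 * ∑ i, ∑ j, G j i * (y i * y j) := by
        simp only [Finset.mul_sum, ← Finset.sum_add_distrib]
        exact Finset.sum_congr rfl fun i _ => Finset.sum_congr rfl fun j _ => by ring
    _ = _ := by rw [h]; ring

/-- Near its minimizer, `f - f(ζ) - (ν/2)‖· - ζ‖²` is a quadratic form in `x - ζ` whose symmetric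
coefficients belong to `H`. -/
lemma exists_local_quadratic_form (hH : RichSpace H m M D) (hΩ : IsOpen Ω) {f : Eucl d → ℝ}
    (hf : ContDiff ℝ 2 f) (hd2 : ∀ i j : Fin d, RestrictsTo H (partialDeriv ![i, j] f))
    {ζ : Eucl d} (hζΩ : ζ ∈ Ω) (hζ : IsGlobalMin f ζ) (ν : ℝ) :
    ∃ v : Fin d → Fin d → Eucl d → ℝ, (∀ i j, RestrictsTo H (v i j)) ∧
      (∀ i j, ContinuousAt (v i j) ζ) ∧ (∀ i j x, v i j x = v j i x) ∧
      ∃ ρ > 0, Metric.ball ζ ρ ⊆ Ω ∧ ∀ x ∈ Metric.ball ζ ρ,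
        f x - f ζ - ν / 2 * ‖x - ζ‖ ^ 2 = ∑ i, ∑ j, v i j x * ((x - ζ) i * (x - ζ) j) := by
  obtain ⟨ρ, hρ, hb⟩ := Metric.isOpen_iff.1 hΩ ζ hζΩ
  choose p hp using hd2
  choose g hg using fun i j => hH.integral_mem ζ ρ hρ hb (p i j)
  let G : Fin d → Fin d → Eucl d → ℝ := fun i j => extendZero fun y : Ω => g i j y
  have hGr : ∀ i j, RestrictsTo H (G i j) := fun i j => restrictsTo_extendZero _
  have hGc : ∀ i j, ContinuousAt (G i j) ζ := fun i j =>
    (contDiffOn_extendZero hH.kernel_contDiff hΩ (g i j)).continuousOn.continuousAt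
      (hΩ.mem_nhds hζΩ)
  have hconst : ∀ c : ℝ, RestrictsTo H fun _ => c := fun c => hH.smooth_mem _ contDiff_const
  refine ⟨fun i j x => 1 / 2 * (G i j x + G j i x) + (if i = j then -(ν / 2) else 0),
    fun i j => ((hconst _).mul hH ((hGr i j).add (hGr j i))).add (hconst _),
    fun i j => (continuousAt_const.mul ((hGc i j).add (hGc j i))).add continuousAt_const,
    fun i j x => by simp only [add_comm (G i j x), eq_comm (a := i)], ρ, hρ, hb, fun x hx => ?_⟩
  have hGx : ∀ i j, G i j x =
      ∫ t in (0 : ℝ)..1, (1 - t) * partialDeriv ![i, j] f (ζ + t • (x - ζ)) := by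
    intro i j
    have hxΩ : x ∈ Ω := hb hx
    have h1 := hg i j ⟨x, hxΩ⟩ hx
    have h2 : G i j x = g i j ⟨x, hxΩ⟩ := extendZero_coe (fun y : Ω => g i j y) ⟨x, hxΩ⟩
    rw [h2, h1]
    refine intervalIntegral.integral_congr fun t ht => ?_
    rw [Set.uIcc_of_le zero_le_one] at ht
    have hmem : ζ + t • (x - ζ) ∈ Ω := hb
      ((convex_ball ζ ρ).add_smul_sub_mem (Metric.mem_ball_self hρ) hx ht)
    simp only
    rw [← hp i j ⟨_, hmem⟩]
    exact congrArg _ (extendZero_coe (fun y : Ω => p i j y) ⟨_, hmem⟩)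
  have hTaylor := map_add_eq_sum_add_integral_iteratedFDeriv (f := f) (x := ζ) (y := x - ζ) (n := 1)
    (fun t _ => by exact_mod_cast hf.contDiffAt)
  have hmin : fderiv ℝ f ζ = 0 :=
    IsLocalMin.fderiv_eq_zero (Filter.Eventually.of_forall hζ)
  rw [add_sub_cancel] at hTaylor
  simp only [Finset.sum_range_succ, Finset.range_zero, Finset.sum_empty, zero_add,
    Nat.factorial_zero, Nat.factorial_one, Nat.cast_one, inv_one,
    iteratedFDeriv_zero_apply, iteratedFDeriv_one_apply, hmin, zero_apply, pow_one,
    smul_eq_mul, Nat.reduceAdd, iteratedFDeriv_two_diag_eq_sum] at hTaylor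
  have hcont : ∀ i j, Continuous fun t : ℝ =>
      (1 - t) * partialDeriv ![i, j] f (ζ + t • (x - ζ)) := by
    intro i j
    have h2 : Continuous (iteratedFDeriv ℝ 2 f) := hf.continuous_iteratedFDeriv le_rfl
    have h3 : Continuous fun z => partialDeriv ![i, j] f z :=
      (ContinuousMultilinearMap.apply ℝ (fun _ : Fin 2 => Eucl d) ℝ
        fun a => EuclideanSpace.single (![i, j] a) (1 : ℝ)).continuous.comp h2
    exact (continuous_const.sub continuous_id).mul (h3.comp (by fun_prop))
  have hint : ∫ t in (0 : ℝ)..1, (1 - t) * ∑ i, ∑ j,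
      partialDeriv ![i, j] f (ζ + t • (x - ζ)) * ((x - ζ) i * (x - ζ) j) =
      ∑ i, ∑ j, G i j x * ((x - ζ) i * (x - ζ) j) := by
    simp only [Finset.mul_sum, ← mul_assoc]
    have hc : ∀ i j, Continuous fun t : ℝ => (1 - t) * partialDeriv ![i, j] f (ζ + t • (x - ζ)) *
        (x - ζ) i * (x - ζ) j := fun i j =>
      ((hcont i j).mul continuous_const).mul continuous_const
    rw [intervalIntegral.integral_finsetSum fun i _ => Continuous.intervalIntegrable
      (continuous_finsetSum _ fun j _ => hc i j) _ _]
    refine Finset.sum_congr rfl fun i _ => ?_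
    rw [intervalIntegral.integral_finsetSum fun j _ => (hc i j).intervalIntegrable _ _]
    refine Finset.sum_congr rfl fun j _ => ?_
    rw [intervalIntegral.integral_mul_const, intervalIntegral.integral_mul_const, hGx]
  rw [hint] at hTaylor
  simp only [add_mul, Finset.sum_add_distrib]
  rw [sum_symmetrize (fun i j => G i j x)]
  have hnorm : ∑ i, ∑ j, (if i = j then -(ν / 2) else 0) * ((x - ζ) i * (x - ζ) j) =
      -(ν / 2) * ‖x - ζ‖ ^ 2 := by
    rw [EuclideanSpace.norm_sq_eq, Finset.mul_sum]
    refine Finset.sum_congr rfl fun i _ => ?_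
    rw [Finset.sum_eq_single i (fun j _ hj => by rw [if_neg hj.symm, zero_mul]) (by simp),
      if_pos rfl,
      Real.norm_eq_abs, sq_abs, sq]
  rw [hnorm, hTaylor]
  ring

/-- Close to the minimizer, `f - f(ζ) - (ν/2)‖· - ζ‖²` is a sum of `d` squares of elements of `H`:
the coefficient matrix of the quadratic form is positive definite at `ζ`, hence factors smoothly. -/
lemma exists_local_sum_squares (hH : RichSpace H m M D) (hΩ : IsOpen Ω) {f : Eucl d → ℝ}
    (hf : ContDiff ℝ 2 f) (hd2 : ∀ i j : Fin d, RestrictsTo H (partialDeriv ![i, j] f))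
    {ζ : Eucl d} (hζΩ : ζ ∈ Ω) (hζ : IsGlobalMin f ζ) {ν β : ℝ} (hν : ν < β)
    (hβ : ∀ x ∈ Ω, β / 2 * ‖x - ζ‖ ^ 2 ≤ f x - f ζ) :
    ∃ L : Fin d → Eucl d → ℝ, (∀ i, RestrictsTo H (L i)) ∧
      ∃ ρ > 0, ∀ x ∈ Metric.ball ζ ρ,
        f x - f ζ - ν / 2 * ‖x - ζ‖ ^ 2 = ∑ i, L i x ^ 2 := by
  obtain ⟨v, hvr, hvc, hvs, ρ, hρ, hb, hq⟩ :=
    exists_local_quadratic_form hH hΩ hf hd2 hζΩ hζ ν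
  set G₀ : Matrix (Fin d) (Fin d) ℝ := Matrix.of fun i j => v i j ζ with hG₀
  have hpos : G₀.PosDef := by
    refine Matrix.PosDef.of_dotProduct_mulVec_pos (Matrix.ext fun i j => ?_) fun y hy => ?_
    · simp [hG₀, hvs j i]
    · set Y : Eucl d := WithLp.toLp 2 y with hY
      have hY0 : 0 < ‖Y‖ := norm_pos_iff.2 fun h => hy (by
        have := congrArg WithLp.ofLp h
        simpa [hY] using this)
      have hform : star y ⬝ᵥ G₀.mulVec y = ∑ i, ∑ j, v i j ζ * (y i * y j) := by
        simp only [dotProduct, Matrix.mulVec, hG₀, Matrix.of_apply, Finset.mul_sum, star_trivial]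
        exact Finset.sum_congr rfl fun i _ => Finset.sum_congr rfl fun j _ => by ring
      -- the quadratic form at `ζ` is the limit of its values at `ζ + s Y`
      have hlim : Filter.Tendsto (fun s : ℝ => ∑ i, ∑ j, v i j (ζ + s • Y) * (y i * y j))
          (nhdsWithin 0 (Set.Ioi 0)) (nhds (∑ i, ∑ j, v i j ζ * (y i * y j))) := by
        refine tendsto_finsetSum _ fun i _ => tendsto_finsetSum _ fun j _ => ?_
        refine Filter.Tendsto.mul_const _ ?_
        refine (hvc i j).tendsto.comp (tendsto_nhdsWithin_of_tendsto_nhds ?_)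
        have : Continuous fun s : ℝ => ζ + s • Y := by fun_prop
        simpa using this.tendsto 0
      have hev : ∀ᶠ s : ℝ in nhdsWithin 0 (Set.Ioi 0),
          (β - ν) / 2 * ‖Y‖ ^ 2 ≤ ∑ i, ∑ j, v i j (ζ + s • Y) * (y i * y j) := by
        filter_upwards [Ioo_mem_nhdsGT (div_pos hρ hY0)] with s hs
        have hx : ζ + s • Y ∈ Metric.ball ζ ρ := by
          rw [Metric.mem_ball, dist_eq_norm, add_sub_cancel_left, norm_smul,
            Real.norm_of_nonneg hs.1.le]
          exact (lt_div_iff₀ hY0).1 hs.2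
        have h1 := hq _ hx
        have h2 := hβ _ (hb hx)
        rw [add_sub_cancel_left, norm_smul, Real.norm_of_nonneg hs.1.le] at h1 h2
        have h3 : ∑ i, ∑ j, v i j (ζ + s • Y) * ((s • Y) i * (s • Y) j) =
            s ^ 2 * ∑ i, ∑ j, v i j (ζ + s • Y) * (y i * y j) := by
          simp only [Finset.mul_sum]
          refine Finset.sum_congr rfl fun i _ => Finset.sum_congr rfl fun j _ => ?_
          simp only [hY, PiLp.smul_apply, smul_eq_mul]
          ring
        rw [h3] at h1
        have hs2 : 0 < s ^ 2 := by have := hs.1; positivity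
        refine le_of_mul_le_mul_left ?_ hs2
        rw [← h1]
        nlinarith
      rw [hform]
      refine lt_of_lt_of_le ?_ (ge_of_tendsto hlim hev)
      have : 0 < β - ν := sub_pos.2 hν
      positivity
  obtain ⟨a, ha, hfac⟩ := exists_smooth_factor hpos
  let V : Eucl d → Eucl (d * d) := fun x => WithLp.toLp 2 fun k =>
    v (finProdFinEquiv.symm k).1 (finProdFinEquiv.symm k).2 x
  have hVG : ∀ x, V x = vecOf (Matrix.of fun i j => v i j x) := fun x => rfl
  have hVc : ContinuousAt V ζ := by
    refine (PiLp.continuous_toLp 2 _).continuousAt.comp ?_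
    exact continuousAt_pi.2 fun k => hvc _ _
  have hfac' : ∀ᶠ x in nhds ζ, (matOf (V x)).IsSymm →
      matOf (V x) = (Matrix.of fun i j => a i j (V x))ᵀ * Matrix.of fun i j => a i j (V x) :=
    hVc.eventually hfac
  obtain ⟨ρ', hρ', hball⟩ := Metric.eventually_nhds_iff_ball.1
    (hfac'.and (Metric.ball_mem_nhds ζ hρ))
  refine ⟨fun i x => ∑ j, a i j (V x) * (x - ζ) j, fun i => RestrictsTo.sum _ fun j =>
    RestrictsTo.mul hH (RestrictsTo.comp hH (ha i j) fun k => hvr _ _) ?_, ρ', hρ', fun x hx => ?_⟩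
  · refine hH.smooth_mem _ ?_
    exact ((EuclideanSpace.proj j : Eucl d →L[ℝ] ℝ).contDiff).comp (contDiff_id.sub contDiff_const)
  · obtain ⟨h1, h2⟩ := hball x hx
    rw [hq x h2]
    rw [hVG, matOf_vecOf] at h1
    have h3 := h1 (Matrix.IsSymm.ext fun i j => hvs _ _ _)
    have h4 : ∀ i j, v i j x = ∑ l, a l i (V x) * a l j (V x) := fun i j => by
      have := congrFun (congrFun h3 i) j
      simpa [Matrix.mul_apply, hVG] using this
    simp only [h4, sq, Finset.sum_mul, Finset.mul_sum]
    rw [Finset.sum_congr rfl fun i _ => Finset.sum_comm, Finset.sum_comm]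
    refine Finset.sum_congr rfl fun l _ => ?_
    rw [Finset.sum_comm]
    exact Finset.sum_congr rfl fun i _ => Finset.sum_congr rfl fun j _ => by ring

/-- On the whole of `Ω`, `f - f(ζ) - (ν/2)‖· - ζ‖²` is a sum of `d + 1` squares of elements of `H`:
the local representation near `ζ` is glued, with `sin² + cos² = 1`, to the square root of the
function away from `ζ`, where it is bounded below. -/
lemma exists_sum_squares (hH : RichSpace H m M D) (hΩ : IsOpen Ω) {f : Eucl d → ℝ}
    (hf : ContDiff ℝ 2 f) (hfH : RestrictsTo H f)
    (hd2 : ∀ i j : Fin d, RestrictsTo H (partialDeriv ![i, j] f))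
    {ζ : Eucl d} (hζΩ : ζ ∈ Ω) (hζ : IsGlobalMin f ζ) {ν β : ℝ} (hν : ν < β)
    (hβ : ∀ x ∈ Ω, β / 2 * ‖x - ζ‖ ^ 2 ≤ f x - f ζ) :
    ∃ w : Fin (d + 1) → H, ∀ x : Ω,
      f x - f ζ - ν / 2 * ‖(x : Eucl d) - ζ‖ ^ 2 = ∑ i, w i x ^ 2 := by
  obtain ⟨L, hL, ρ, hρ, hLρ⟩ := exists_local_sum_squares hH hΩ hf hd2 hζΩ hζ hν hβ
  set g : Eucl d → ℝ := fun x => f x + (-f ζ - ν / 2 * ‖x - ζ‖ ^ 2) with hg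
  have hgH : RestrictsTo H g := hfH.add (hH.smooth_mem _ (by
    exact contDiff_const.sub (contDiff_const.mul
      ((contDiff_id.sub contDiff_const).norm_sq ℝ))))
  let χ : ContDiffBump ζ := ⟨ρ / 3, ρ / 2, by positivity, by linarith⟩
  have hχs : ContDiff ℝ ∞ fun x => Real.pi / 2 * χ x := contDiff_const.mul χ.contDiff
  have hβν : 0 < β - ν := sub_pos.2 hν
  obtain ⟨s, hs, hsq⟩ := exists_smooth_real_sqrt
    (δ := (β - ν) / 2 * (ρ / 3) ^ 2) (by positivity)
  have h0 : RestrictsTo H fun x => Real.cos (Real.pi / 2 * χ x) * s (g x) := by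
    refine (hH.smooth_mem _ (Real.contDiff_cos.comp hχs)).mul hH ?_
    have := RestrictsTo.comp hH (p := 1) (a := fun y => s (y 0))
      (hs.comp (EuclideanSpace.proj (0 : Fin 1) : Eucl 1 →L[ℝ] ℝ).contDiff) (fun _ => hgH)
    exact this
  have hi : ∀ i, RestrictsTo H fun x => Real.sin (Real.pi / 2 * χ x) * L i x := fun i =>
    (hH.smooth_mem _ (Real.contDiff_sin.comp hχs)).mul hH (hL i)
  obtain ⟨w₀, hw₀⟩ := h0
  choose w hw using hi
  refine ⟨Fin.cons w₀ w, fun x => ?_⟩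
  rw [Fin.sum_univ_succ]
  simp only [Fin.cons_zero, Fin.cons_succ, hw₀, hw, mul_pow, ← Finset.mul_sum]
  have hgx : f x - f ζ - ν / 2 * ‖(x : Eucl d) - ζ‖ ^ 2 = g x := by rw [hg]; ring
  have hsin : Real.sin (Real.pi / 2 * χ x) ^ 2 * ∑ i, L i x ^ 2 =
      Real.sin (Real.pi / 2 * χ x) ^ 2 * g x := by
    by_cases hx : (x : Eucl d) ∈ Metric.ball ζ ρ
    · rw [← hLρ x hx, hgx]
    · rw [Metric.mem_ball, not_lt] at hx
      have : χ (x : Eucl d) = 0 := χ.zero_of_le_dist (by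
        change ρ / 2 ≤ _; linarith)
      rw [this]
      simp
  have hcos : Real.cos (Real.pi / 2 * χ x) ^ 2 * s (g x) ^ 2 =
      Real.cos (Real.pi / 2 * χ x) ^ 2 * g x := by
    by_cases hx : (x : Eucl d) ∈ Metric.closedBall ζ (ρ / 3)
    · have : χ (x : Eucl d) = 1 := χ.one_of_mem_closedBall hx
      rw [this]
      simp
    · rw [Metric.mem_closedBall, not_le, dist_eq_norm] at hx
      rw [hsq _ ?_]
      have h1 := hβ x x.2
      have h2 : (ρ / 3) ^ 2 ≤ ‖(x : Eucl d) - ζ‖ ^ 2 := by gcongr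
      rw [← hgx]
      nlinarith
  rw [hsin, hcos, hgx, ← add_mul, Real.cos_sq_add_sin_sq, one_mul]

/-- Every feasible value of the infinite-dimensional problem is at most `f(ζ)`. -/
lemma IsFeasibleInf.objective_le {f : Eucl d → ℝ} {ν c : ℝ} {z ζ : Eucl d} {A : H →L[ℝ] H}
    (hν : 0 ≤ ν) (h : IsFeasibleInf f ν c z A) (hζ : ζ ∈ Ω) : c - ν / 2 * ‖z‖ ^ 2 ≤ f ζ := by
  have h1 := h.2 ⟨ζ, hζ⟩
  have h2 := h.1.inner_nonneg_right (feature H ⟨ζ, hζ⟩)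
  rw [← h1] at h2
  have h3 : 0 ≤ ν / 2 * ‖ζ - z‖ ^ 2 := by positivity
  rw [norm_sub_sq_real] at h3
  simp only at h2
  linarith

/-- The infinite-dimensional problem has a solution of rank at most `d + 1`. -/
theorem exists_isSolutionInf (hH : RichSpace H m M D) (hΩ : IsOpen Ω) {f : Eucl d → ℝ}
    (hf : ContDiff ℝ 2 f) (hanalytic : AnalyticAssumption H f)
    {ζ : Eucl d} (hζΩ : ζ ∈ Ω) (hζ : IsGlobalMin f ζ) {ν β : ℝ} (hν0 : 0 ≤ ν) (hν : ν < β)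
    (hβ : ∀ x ∈ Ω, β / 2 * ‖x - ζ‖ ^ 2 ≤ f x - f ζ) :
    ∃ (A : H →L[ℝ] H) (τ : ℝ), IsSolutionInf f ν (f ζ + ν / 2 * ‖ζ‖ ^ 2) ζ A ∧
      LinearMap.rank (A : H →ₗ[ℝ] H) ≤ (d + 1 : ℕ) ∧ HasTrace A τ := by
  obtain ⟨w, hw⟩ := exists_sum_squares hH hΩ hf hanalytic.mem hanalytic.deriv_mem hζΩ hζ hν hβ
  refine ⟨sumSquaresOp w, _, ⟨⟨isPositive_sumSquaresOp w, fun x => ?_⟩, fun c' z' A' h => ?_⟩,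
    rank_sumSquaresOp_le w, hasTrace_sumSquaresOp w⟩
  · rw [inner_sumSquaresOp]
    simp only [inner_feature_left]
    rw [← hw x, norm_sub_sq_real]
    ring
  · have := h.objective_le hν0 hζΩ
    linarith

end Representation

/-! ### The data points: orthonormal coordinates and compressions -/

section Compression

variable {d n : ℕ} {Ω : Set (Eucl d)} {H : Type*} [NormedAddCommGroup H] [InnerProductSpace ℝ H]
  [CompleteSpace H] [RKHS ℝ H Ω ℝ] {m : ℕ} {M D : ℝ}

/-- The features of distinct points are linearly independent, because `H` contains polynomials. -/
lemma linearIndependent_feature (hH : RichSpace H m M D) {X : Fin n → Ω}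
    (hX : Function.Injective X) : LinearIndependent ℝ fun i => feature H (X i) := by
  classical
  rw [Fintype.linearIndependent_iff]
  intro c hc i
  obtain ⟨w, hw⟩ := hH.smooth_mem (fun x => ∏ j ∈ Finset.univ.erase i, ‖x - X j‖ ^ 2)
    (contDiff_prod fun j _ => (contDiff_id.sub contDiff_const).norm_sq ℝ)
  have h0 : ∑ j, c j * w (X j) = 0 := by
    have := congrArg (fun y => inner ℝ w y) hc
    simpa [inner_sum, inner_smul_right, inner_feature_right] using this
  rw [Finset.sum_eq_single i (fun j _ hj => ?_) (by simp), hw] at h0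
  · refine (mul_eq_zero.1 h0).resolve_right (Finset.prod_ne_zero_iff.2 fun j hj => ?_)
    refine pow_ne_zero 2 (norm_ne_zero_iff.2 (sub_ne_zero.2 fun h => ?_))
    exact (Finset.ne_of_mem_erase hj) (hX (Subtype.ext h)).symm
  · have : w (X j) = 0 := by
      rw [hw]
      exact Finset.prod_eq_zero (Finset.mem_erase.2 ⟨hj, Finset.mem_univ j⟩) (by simp)
    rw [this, mul_zero]

/-- The vectors `Φ_i` are the coordinates of the features of the data points with respect to an
orthonormal family of `H`. -/
lemma exists_orthonormal_coordinates (hH : RichSpace H m M D) {X : Fin n → Ω}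
    (hX : Function.Injective X) :
    ∃ v : Fin n → H, Orthonormal ℝ v ∧ ∀ i, feature H (X i) = ∑ l, Phi H X i l • v l := by
  classical
  set K := kernelMatrix H X with hK
  set R := cholesky K (kernelMatrix_posSemidef H X) with hR
  have hKR : K = Rᵀ * R :=
    (exists_isCholeskyFactor (kernelMatrix_posSemidef H X)).choose_spec.factor
  have hunit : IsUnit R := by
    rw [← Matrix.mulVec_injective_iff_isUnit]
    have hli := Fintype.linearIndependent_iff.1 (linearIndependent_feature hH hX)
    intro a b hab
    have hsub : R.mulVec (a - b) = 0 := by rw [Matrix.mulVec_sub, hab, sub_self]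
    have hK0 : K.mulVec (a - b) = 0 := by
      rw [hKR, ← Matrix.mulVec_mulVec, hsub, Matrix.mulVec_zero]
    have hz : ∑ i, (a - b) i • feature H (X i) = 0 := by
      rw [← inner_self_eq_zero (𝕜 := ℝ), sum_inner]
      refine Finset.sum_eq_zero fun i _ => ?_
      rw [inner_smul_left, inner_sum]
      have := congrFun hK0 i
      simp only [Matrix.mulVec, dotProduct, Pi.zero_apply] at this
      have h2 : ∑ j, inner ℝ (feature H (X i)) ((a - b) j • feature H (X j)) =
          ∑ j, K i j * (a - b) j := Finset.sum_congr rfl fun j _ => by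
        rw [inner_smul_right, hK, kernelMatrix, Matrix.of_apply, ker_eq_inner, mul_comm]
      rw [h2, this, mul_zero]
    funext i
    exact sub_eq_zero.1 (hli _ hz i)
  have hdet : IsUnit R.det := (Matrix.isUnit_iff_isUnit_det R).1 hunit
  let W := R⁻¹
  have hWR : W * R = 1 := Matrix.nonsing_inv_mul _ hdet
  have hRW : R * W = 1 := Matrix.mul_nonsing_inv _ hdet
  refine ⟨fun l => ∑ i, W i l • feature H (X i), ?_, fun i => ?_⟩
  · rw [orthonormal_iff_ite]
    intro l k
    have h1 : Wᵀ * K * W = 1 := by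
      rw [hKR, mul_assoc, mul_assoc, hRW, mul_one, ← Matrix.transpose_mul, hRW,
        Matrix.transpose_one]
    have h2 := congrFun (congrFun h1 l) k
    rw [Matrix.one_apply] at h2
    rw [← h2, Matrix.mul_assoc, Matrix.mul_apply, sum_inner]
    refine Finset.sum_congr rfl fun i _ => ?_
    rw [inner_smul_left, inner_sum, Matrix.transpose_apply, Matrix.mul_apply, conj_trivial]
    congr 1
    refine Finset.sum_congr rfl fun j _ => ?_
    rw [inner_smul_right, hK, kernelMatrix, Matrix.of_apply, ker_eq_inner, mul_comm]
  · have h1 : ∀ j, ∑ l, W j l * R l i = if j = i then 1 else 0 := fun j => by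
      rw [← Matrix.mul_apply, hWR, Matrix.one_apply]
    simp only [Finset.smul_sum, smul_smul]
    rw [Finset.sum_comm]
    have h2 : ∀ j, ∑ l, (Phi H X i l * W j l) • feature H (X j) =
        if j = i then feature H (X j) else 0 := fun j => by
      rw [← Finset.sum_smul]
      have : ∑ l, Phi H X i l * W j l = ∑ l, W j l * R l i :=
        Finset.sum_congr rfl fun l _ => mul_comm _ _
      rw [this, h1 j]
      split_ifs <;> simp
    simp [h2]

lemma sum_inner_orthonormal_le {v : Fin n → H} (hv : Orthonormal ℝ v) {A : H →L[ℝ] H}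
    (hA : A.IsPositive) {τ : ℝ} (hτ : HasTrace A τ) : ∑ l, inner ℝ (v l) (A (v l)) ≤ τ := by
  obtain ⟨w, b, hw, hb⟩ := hv.toSubtypeRange.exists_hilbertBasis_extension
  have hinj : Function.Injective v := hv.linearIndependent.injective
  let e : Fin n ↪ w := ⟨fun l => ⟨v l, hw ⟨l, rfl⟩⟩, fun i j h => hinj (congrArg Subtype.val h)⟩
  have h1 := sum_le_hasSum (Finset.univ.map e) (fun i _ => hA.inner_nonneg_right _) (hτ w b)
  rw [Finset.sum_map] at h1
  simp only [hb] at h1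
  exact h1

/-- Compressing a positive operator to the span of the features of the data points yields a positive
semidefinite matrix with the same values at the data points, and the trace does not increase. -/
lemma exists_compression (hH : RichSpace H m M D) {X : Fin n → Ω} (hX : Function.Injective X)
    {A : H →L[ℝ] H} (hA : A.IsPositive) :
    ∃ B : Matrix (Fin n) (Fin n) ℝ, B.PosSemidef ∧
      (∀ i, inner ℝ (feature H (X i)) (A (feature H (X i))) = Phi H X i ⬝ᵥ (B *ᵥ Phi H X i)) ∧
      ∀ τ, HasTrace A τ → B.trace ≤ τ := by
  obtain ⟨v, hv, hφ⟩ := exists_orthonormal_coordinates hH hX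
  let B : Matrix (Fin n) (Fin n) ℝ := Matrix.of fun l k => inner ℝ (v l) (A (v k))
  have hform : ∀ c : Fin n → ℝ, c ⬝ᵥ (B *ᵥ c) =
      inner ℝ (∑ l, c l • v l) (A (∑ l, c l • v l)) := by
    intro c
    simp only [map_sum, map_smul, sum_inner, inner_sum, inner_smul_left, inner_smul_right,
      conj_trivial, dotProduct, Matrix.mulVec, Finset.mul_sum, B, Matrix.of_apply]
    rw [Finset.sum_comm]
    exact Finset.sum_congr rfl fun i _ => Finset.sum_congr rfl fun j _ => by ring
  refine ⟨B, ?_, fun i => by rw [hform, ← hφ], fun τ hτ => ?_⟩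
  · refine Matrix.PosSemidef.of_dotProduct_mulVec_nonneg (Matrix.ext fun i j => ?_) fun c => ?_
    · simp only [Matrix.conjTranspose_apply, star_trivial, B, Matrix.of_apply]
      rw [real_inner_comm]
      exact hA.isSymmetric (v i) (v j)
    · rw [star_trivial, hform]
      exact hA.inner_nonneg_right _
  · exact sum_inner_orthonormal_le hv hA hτ

/-- A positive semidefinite matrix `B` defines a nonnegative function in `H` whose values at the data
points are `Φ_iᵀ B Φ_i` and whose norm is at most `M * tr B`. -/
lemma exists_nonneg_interpolant (hH : RichSpace H m M D) {X : Fin n → Ω}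
    (hX : Function.Injective X) {B : Matrix (Fin n) (Fin n) ℝ} (hB : B.PosSemidef) :
    ∃ ρ : H, (∀ x, 0 ≤ ρ x) ∧ (∀ i, ρ (X i) = Phi H X i ⬝ᵥ (B *ᵥ Phi H X i)) ∧
      ‖ρ‖ ≤ M * B.trace := by
  obtain ⟨v, hv, hφ⟩ := exists_orthonormal_coordinates hH hX
  obtain ⟨S, hS⟩ : ∃ S : Matrix (Fin n) (Fin n) ℝ, B = Sᵀ * S := by
    open scoped MatrixOrder in
    exact CStarAlgebra.nonneg_iff_eq_star_mul_self.mp hB.nonneg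
  let w : Fin n → H := fun a => ∑ l, S a l • v l
  choose p hp hpn using fun a => hH.mul_mem (w a) (w a)
  have hval : ∀ x, (∑ a, p a : H) x = ∑ a, w a x ^ 2 := by
    intro x
    rw [← inner_feature_right, sum_inner]
    exact Finset.sum_congr rfl fun a _ => by rw [inner_feature_right, hp, sq]
  refine ⟨∑ a, p a, fun x => ?_, fun i => ?_, ?_⟩
  · rw [hval]; positivity
  · have hwi : ∀ a, w a (X i) = (S *ᵥ Phi H X i) a := by
      intro a
      rw [← inner_feature_right, hφ, hv.inner_sum]
      simp [Matrix.mulVec, dotProduct]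
    rw [hval, hS, ← Matrix.mulVec_mulVec, Matrix.dotProduct_mulVec, Matrix.vecMul_transpose]
    exact Finset.sum_congr rfl fun a _ => by rw [hwi, sq]
  · have htr : B.trace = ∑ a, ‖w a‖ ^ 2 := by
      rw [hS, Matrix.trace]
      simp only [Matrix.diag_apply, Matrix.mul_apply, Matrix.transpose_apply]
      rw [Finset.sum_comm]
      refine Finset.sum_congr rfl fun a _ => ?_
      rw [← real_inner_self_eq_norm_sq, hv.inner_sum]
      simp
    rw [htr, Finset.mul_sum]
    refine (norm_sum_le _ _).trans (Finset.sum_le_sum fun a _ => (hpn a).trans_eq (by ring))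

end Compression

/-! ### Solvability of the semidefinite program -/

section Solvability

lemma abs_apply_le_trace {n : ℕ} {B : Matrix (Fin n) (Fin n) ℝ} (hB : B.PosSemidef) (i j : Fin n) :
    |B i j| ≤ B.trace := by
  classical
  have hdiag : ∀ i, 0 ≤ B i i := fun i => by
    have := hB.dotProduct_mulVec_nonneg (Pi.single i 1)
    simpa using this
  have hle : ∀ i, B i i ≤ B.trace := fun i =>
    Finset.single_le_sum (f := fun i => B i i) (fun i _ => hdiag i) (Finset.mem_univ i)
  have hsymm : B j i = B i j := by
    have := hB.isHermitian.apply i j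
    simpa using this
  have h1 := hB.dotProduct_mulVec_nonneg (Pi.single i 1 + Pi.single j 1)
  have h2 := hB.dotProduct_mulVec_nonneg (Pi.single i 1 - Pi.single j 1)
  simp only [star_trivial, Matrix.mulVec_add, Matrix.mulVec_sub, Matrix.mulVec_single_one,
    add_dotProduct, dotProduct_add, sub_dotProduct, dotProduct_sub, single_one_dotProduct,
    Matrix.col_apply, hsymm] at h1 h2
  have h3 := hle i
  have h4 := hle j
  exact abs_le.2 ⟨by linarith, by linarith⟩

variable {d n : ℕ} {Ω : Set (Eucl d)} {H : Type*} [NormedAddCommGroup H] [InnerProductSpace ℝ H]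
  [CompleteSpace H] [RKHS ℝ H Ω ℝ]

/-- A feasible semidefinite program has a solution: the feasible points that are at least as good as
a given one form a compact set. For `ν = 0` the vector `z` plays no role and is normalized to `0`. -/
theorem exists_isSolutionSDP (hn : 1 ≤ n) {f : Eucl d → ℝ} {X : Fin n → Ω} {ν lam : ℝ}
    (hν : 0 ≤ ν) (hlam : 0 < lam) {c₀ : ℝ} {z₀ : Eucl d} {B₀ : Matrix (Fin n) (Fin n) ℝ}
    (h₀ : IsFeasibleSDP H f X ν c₀ z₀ B₀) :
    ∃ (c : ℝ) (z : Eucl d) (B : Matrix (Fin n) (Fin n) ℝ), IsSolutionSDP H f X ν lam c z B := by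
  let V : ℝ × Eucl d × (Fin n → Fin n → ℝ) → ℝ := fun p =>
    p.1 - ν / 2 * ‖p.2.1‖ ^ 2 - lam * (Matrix.of p.2.2).trace
  have hVc : Continuous V := by
    have : Continuous fun p : ℝ × Eucl d × (Fin n → Fin n → ℝ) => (Matrix.of p.2.2).trace := by
      simp only [Matrix.trace, Matrix.diag_apply, Matrix.of_apply]
      fun_prop
    fun_prop
  set V₀ := c₀ - ν / 2 * ‖z₀‖ ^ 2 - lam * B₀.trace with hV₀
  let 𝒮 : Set (ℝ × Eucl d × (Fin n → Fin n → ℝ)) :=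
    {p | IsFeasibleSDP H f X ν p.1 p.2.1 (Matrix.of p.2.2) ∧ V₀ ≤ V p ∧ (ν = 0 → p.2.1 = 0)}
  -- normalizing `z` in the case `ν = 0`
  have hnorm : ∀ (c : ℝ) (z : Eucl d) (B : Matrix (Fin n) (Fin n) ℝ),
      IsFeasibleSDP H f X ν c z B → V₀ ≤ c - ν / 2 * ‖z‖ ^ 2 - lam * B.trace →
      ∃ p ∈ 𝒮, V p = c - ν / 2 * ‖z‖ ^ 2 - lam * B.trace := by
    intro c z B hB hV
    by_cases hν0 : ν = 0
    · have hof : (Matrix.of B).trace = B.trace := rfl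
      refine ⟨(c, 0, B), ⟨⟨hB.1, fun i => ?_⟩, ?_, fun _ => rfl⟩, ?_⟩
      · have := hB.2 i
        simp only [hν0, zero_div, zero_mul] at this ⊢
        exact this
      · simpa [V, hν0, hof] using hV
      · simp [V, hν0, hof]
    · exact ⟨(c, z, B), ⟨hB, hV, fun h => absurd h hν0⟩, rfl⟩
  have hclosed : IsClosed 𝒮 := by
    refine IsClosed.inter ?_ (IsClosed.inter (isClosed_le continuous_const hVc) ?_)
    · refine IsClosed.inter ?_ ?_
      · have hset : {p : ℝ × Eucl d × (Fin n → Fin n → ℝ) | (Matrix.of p.2.2).PosSemidef} =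
            {p | ∀ i j, p.2.2 j i = p.2.2 i j} ∩
            {p | ∀ x : Fin n → ℝ, 0 ≤ star x ⬝ᵥ (Matrix.of p.2.2 *ᵥ x)} := by
          ext p
          simp only [Set.mem_ofPred_eq, Set.mem_inter_iff, Matrix.posSemidef_iff_dotProduct_mulVec,
            Matrix.IsHermitian.ext_iff, Matrix.of_apply, star_trivial]
        change IsClosed {p : ℝ × Eucl d × (Fin n → Fin n → ℝ) | (Matrix.of p.2.2).PosSemidef}
        rw [hset]
        refine IsClosed.inter ?_ ?_
        · simp only [Set.ofPred_forall]
          exact isClosed_iInter fun i => isClosed_iInter fun j =>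
            isClosed_eq (by fun_prop) (by fun_prop)
        · simp only [Set.ofPred_forall]
          refine isClosed_iInter fun x => isClosed_le continuous_const ?_
          simp only [dotProduct, Matrix.mulVec, Matrix.of_apply]
          fun_prop
      · change IsClosed {p : ℝ × Eucl d × (Fin n → Fin n → ℝ) | ∀ i : Fin n,
          f (X i) - ν / 2 * ‖(X i : Eucl d)‖ ^ 2 + ν * inner ℝ (X i : Eucl d) p.2.1 - p.1 =
            Phi H X i ⬝ᵥ (Matrix.of p.2.2 *ᵥ Phi H X i)}
        simp only [Set.ofPred_forall]
        refine isClosed_iInter fun i => isClosed_eq (by fun_prop) ?_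
        simp only [dotProduct, Matrix.mulVec, Matrix.of_apply]
        fun_prop
    · by_cases hν0 : ν = 0
      · simp only [hν0, forall_const]
        exact isClosed_eq (by fun_prop) continuous_const
      · simp only [hν0, false_imp_iff]
        exact isClosed_univ
  let i₀ : Fin n := ⟨0, hn⟩
  set x₀ : Eucl d := ↑(X i₀) with hx₀
  set T := (f x₀ - V₀) / lam with hT
  set Q := if ν = 0 then 0 else ‖x₀‖ + √(2 * (f x₀ - V₀) / ν) with hQ
  have hsub : 𝒮 ⊆ Set.Icc V₀ (f x₀ + ν * (‖x₀‖ * Q)) ×ˢ (Metric.closedBall 0 Q ×ˢ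
      Set.univ.pi fun _ => Set.univ.pi fun _ => Set.Icc (-T) T) := by
    rintro ⟨c, z, B⟩ ⟨⟨hB, hfeas⟩, hV, hz0⟩
    have h1 := hfeas i₀
    have h2 : 0 ≤ Phi H X i₀ ⬝ᵥ (Matrix.of B *ᵥ Phi H X i₀) := by
      simpa using hB.dotProduct_mulVec_nonneg (Phi H X i₀)
    rw [← h1] at h2
    simp only [← hx₀] at h2
    have htr := hB.trace_nonneg
    change V₀ ≤ c - ν / 2 * ‖z‖ ^ 2 - lam * (Matrix.of B).trace at hV
    simp only at hz0
    have hsq : 0 ≤ ν / 2 * ‖x₀ - z‖ ^ 2 := by positivity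
    have hlt : 0 ≤ lam * (Matrix.of B).trace := by positivity
    have hsq' := hsq
    rw [norm_sub_sq_real] at hsq'
    have hkey : ν / 2 * ‖x₀ - z‖ ^ 2 + lam * (Matrix.of B).trace ≤ f x₀ - V₀ := by
      rw [norm_sub_sq_real]; linarith
    have hzQ : ‖z‖ ≤ Q := by
      by_cases hν0 : ν = 0
      · rw [hz0 hν0, hQ, if_pos hν0, norm_zero]
      · have hνpos : 0 < ν := lt_of_le_of_ne hν (Ne.symm hν0)
        rw [hQ, if_neg hν0]
        have : ‖x₀ - z‖ ≤ √(2 * (f x₀ - V₀) / ν) := by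
          refine Real.le_sqrt_of_sq_le ?_
          rw [le_div_iff₀ hνpos]
          linarith
        have h3 := norm_sub_norm_le z x₀
        rw [norm_sub_rev] at h3
        linarith
    refine ⟨⟨?_, ?_⟩, ?_, ?_⟩
    · have : 0 ≤ ν / 2 * ‖z‖ ^ 2 := by positivity
      simp only
      linarith
    · have h3 : inner ℝ x₀ z ≤ ‖x₀‖ * Q :=
        (real_inner_le_norm _ _).trans (by gcongr)
      have h4 : ν * inner ℝ x₀ z ≤ ν * (‖x₀‖ * Q) := by gcongr
      have h5 : 0 ≤ ν / 2 * ‖x₀‖ ^ 2 := by positivity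
      simp only
      linarith
    · simpa using hzQ
    · simp only [Set.mem_pi, Set.mem_univ, true_imp_iff]
      intro i j
      have h3 := abs_apply_le_trace hB i j
      refine Set.mem_Icc.2 (abs_le.1 (h3.trans ?_))
      rw [hT, le_div_iff₀ hlam]
      linarith
  have hcompact : IsCompact 𝒮 :=
    (isCompact_Icc.prod ((isCompact_closedBall _ _).prod
      (isCompact_univ_pi fun _ => isCompact_univ_pi fun _ => isCompact_Icc))).of_isClosed_subset
      hclosed hsub
  obtain ⟨p₀, hp₀, -⟩ := hnorm c₀ z₀ B₀ h₀ le_rfl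
  obtain ⟨p, hp, hmax⟩ := hcompact.exists_isMaxOn ⟨p₀, hp₀⟩ hVc.continuousOn
  refine ⟨p.1, p.2.1, Matrix.of p.2.2, hp.1, fun c' z' B' h' => ?_⟩
  by_cases hlow : V₀ ≤ c' - ν / 2 * ‖z'‖ ^ 2 - lam * B'.trace
  · obtain ⟨q, hq, hVq⟩ := hnorm c' z' B' h' hlow
    rw [← hVq]
    exact hmax hq
  · exact (not_le.1 hlow).le.trans hp.2.1

end Solvability

/-! ### Error bounds -/

section ErrorBounds

variable {d n : ℕ} {Ω : Set (Eucl d)} {H : Type*} [NormedAddCommGroup H] [InnerProductSpace ℝ H]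
  [RKHS ℝ H Ω ℝ] {m : ℕ}

lemma partialDeriv_congr {u v : Eucl d → ℝ} (hΩ : IsOpen Ω) (h : Set.EqOn u v Ω)
    (I : Fin m → Fin d) {x : Eucl d} (hx : x ∈ Ω) : partialDeriv I u x = partialDeriv I v x := by
  have : u =ᶠ[nhds x] v := Filter.eventuallyEq_of_mem (hΩ.mem_nhds hx) h
  rw [partialDeriv, partialDeriv, (this.iteratedFDeriv ℝ m).eq_of_nhds]

lemma eqOn_extendZero {f : Eucl d → ℝ} {g : H} (hg : ∀ x : Ω, g x = f x) :
    Set.EqOn f (extendZero fun y : Ω => g y) Ω := fun x hx =>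
  ((extendZero_coe (fun y : Ω => g y) ⟨x, hx⟩).trans (hg ⟨x, hx⟩)).symm

variable [CompleteSpace H] {M D : ℝ}

lemma RestrictsTo.contDiffOn (hH : RichSpace H m M D) (hΩ : IsOpen Ω) {f : Eucl d → ℝ}
    (hf : RestrictsTo H f) : ContDiffOn ℝ m f Ω := by
  obtain ⟨g, hg⟩ := hf
  exact (contDiffOn_extendZero hH.kernel_contDiff hΩ g).congr (eqOn_extendZero hg)

/-- For `f` in `H` the suprema in `derivSeminorm` are finite, so they bound the derivatives. -/
lemma abs_partialDeriv_le_derivSeminorm (hH : RichSpace H m M D) (hΩ : IsOpen Ω) {f : Eucl d → ℝ}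
    (hf : RestrictsTo H f) (I : Fin m → Fin d) {x : Eucl d} (hx : x ∈ Ω) :
    |partialDeriv I f x| ≤ derivSeminorm Ω m f := by
  obtain ⟨g, hg⟩ := hf
  have hb : ∀ (I : Fin m → Fin d) (x : Ω), |partialDeriv I f x| ≤ D * ‖g‖ := fun I x => by
    rw [partialDeriv_congr hΩ (eqOn_extendZero hg) I x.2]
    exact abs_partialDeriv_extendZero_le hH.kernel_contDiff hΩ (zero_le_one.trans hH.one_le_D)
      hH.kernel_bound g I x.2
  have h1 : |partialDeriv I f x| ≤ ⨆ x : Ω, |partialDeriv I f x| :=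
    le_ciSup (f := fun x : Ω => |partialDeriv I f x|)
      ⟨D * ‖g‖, by rintro _ ⟨x, rfl⟩; exact hb I x⟩ ⟨x, hx⟩
  exact h1.trans (le_ciSup (f := fun I : Fin m → Fin d => ⨆ x : Ω, |partialDeriv I f x|)
    (Set.finite_range _).bddAbove I)

lemma derivSeminorm_nonneg (u : Eucl d → ℝ) : 0 ≤ derivSeminorm Ω m u :=
  Real.iSup_nonneg fun _ => Real.iSup_nonneg fun _ => abs_nonneg _

/-- The quadratic part of the constraint contributes at most `ν` to the derivatives of any order
`m ≥ 2`. -/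
lemma abs_partialDeriv_quadratic_le (hm : 2 ≤ m) {ν : ℝ} (hν : 0 ≤ ν) (c : ℝ) (z : Eucl d)
    (I : Fin m → Fin d) (x : Eucl d) :
    |partialDeriv I (fun x => -(ν / 2) * ‖x‖ ^ 2 + ν * inner ℝ x z - c) x| ≤ ν := by
  obtain ⟨k, rfl⟩ : ∃ k, m = k + 1 + 1 := ⟨m - 2, by omega⟩
  have h1 : (fun y => fderiv ℝ (fun x : Eucl d => -(ν / 2) * ‖x‖ ^ 2 + ν * inner ℝ x z - c) y) =
      fun y => (-ν) • innerSL ℝ y + ν • innerSL ℝ z := by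
    funext y
    refine HasFDerivAt.fderiv ?_
    have e1 := ((hasFDerivAt_id (𝕜 := ℝ) y).norm_sq).const_mul (-(ν / 2))
    have e2 := ((innerSL ℝ z).hasFDerivAt (x := y)).const_mul ν
    have e3 := (e1.add e2).sub_const c
    refine (e3.congr_fderiv ?_).congr_of_eventuallyEq (Filter.Eventually.of_forall fun x => ?_)
    · ext w
      simp
      ring
    · simp [real_inner_comm]
  have h2 : (fun y => fderiv ℝ (fun y : Eucl d => (-ν) • innerSL ℝ y + ν • innerSL ℝ z) y) =
      fun _ => (-ν) • innerSL ℝ := by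
    funext y
    exact (((innerSL ℝ (E := Eucl d)).hasFDerivAt.const_smul (-ν)).add_const _).fderiv
  rw [partialDeriv, iteratedFDeriv_succ_apply_right, h1, iteratedFDeriv_succ_apply_right, h2]
  rcases Nat.eq_zero_or_pos k with rfl | hk
  · rw [iteratedFDeriv_zero_apply]
    simp only [FunLike.coe_smul, Pi.smul_apply, smul_eq_mul]
    rw [abs_mul, abs_neg, abs_of_nonneg hν]
    refine mul_le_of_le_one_right hν ((abs_real_inner_le_norm
      (EuclideanSpace.single (I (Fin.last 0).castSucc) (1 : ℝ))
      (EuclideanSpace.single (I (Fin.last (0 + 1))) (1 : ℝ))).trans ?_)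
    simp
  · rw [iteratedFDeriv_const_of_ne hk.ne']
    simpa using hν

/-- A posteriori bound: if the constraint holds at the data points, then it fails by at most
`η (|f|_{Ω,m} + ν + M D tr B)` from below on the whole of `Ω`. -/
lemma neg_eta_mul_le_of_isFeasibleSDP (hd : 1 ≤ d) (hn : 1 ≤ n) {r : ℝ}
    (hΩ : IsUnionOfBalls Ω r) {X : Fin n → Ω} (hX : Function.Injective X) (hm : 2 ≤ m)
    (hH : RichSpace H m M D) {f : Eucl d → ℝ} (hf : RestrictsTo H f) {ν : ℝ} (hν : 0 ≤ ν)
    (hfill : fillDistance Ω X ≤ r / (18 * ((m : ℝ) - 1) ^ 2)) {c : ℝ} {z : Eucl d}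
    {B : Matrix (Fin n) (Fin n) ℝ} (hB : IsFeasibleSDP H f X ν c z B) {x : Eucl d} (hx : x ∈ Ω) :
    -(eta Ω X m * (derivSeminorm Ω m f + ν + M * D * B.trace)) ≤
      f x - ν / 2 * ‖x‖ ^ 2 + ν * inner ℝ x z - c := by
  have hopen := hΩ.isOpen
  obtain ⟨ρ, hρ0, hρX, hρn⟩ := exists_nonneg_interpolant hH hX hB.1
  set q : Eucl d → ℝ := fun x => -(ν / 2) * ‖x‖ ^ 2 + ν * inner ℝ x z - c with hq
  have hqs : ContDiff ℝ m q := by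
    exact ((contDiff_const.mul (contDiff_norm_sq ℝ)).add
      (contDiff_const.mul (contDiff_id.inner ℝ contDiff_const))).sub contDiff_const
  set p : Eucl d → ℝ := extendZero fun y : Ω => ρ y with hp
  have hfs := hf.contDiffOn hH hopen
  have hps : ContDiffOn ℝ m p Ω := contDiffOn_extendZero hH.kernel_contDiff hopen ρ
  have hD0 : 0 ≤ D := zero_le_one.trans hH.one_le_D
  have hpx : ∀ y : Ω, p y = ρ y := extendZero_coe fun y : Ω => ρ y
  have hb : ∀ (I : Fin m → Fin d), ∀ y ∈ Ω, |partialDeriv I (fun x => f x + q x - p x) y| ≤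
      derivSeminorm Ω m f + ν + M * D * B.trace := by
    intro I y hy
    have c1 := hfs.contDiffAt (hopen.mem_nhds hy)
    have c2 : ContDiffAt ℝ m q y := hqs.contDiffAt
    have c3 := hps.contDiffAt (hopen.mem_nhds hy)
    have e : partialDeriv I (fun x => f x + q x - p x) y =
        partialDeriv I f y + partialDeriv I q y - partialDeriv I p y := by
      simp only [partialDeriv]
      rw [fun_iteratedFDeriv_sub_apply (c1.add c2) c3, fun_iteratedFDeriv_add_apply c1 c2]
      rfl
    rw [e]
    have h1 := abs_partialDeriv_le_derivSeminorm hH hopen hf I hy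
    have h2 := abs_partialDeriv_quadratic_le hm hν c z I y
    have h3 := abs_partialDeriv_extendZero_le hH.kernel_contDiff hopen hD0 hH.kernel_bound ρ I hy
    have h4 : D * ‖ρ‖ ≤ M * D * B.trace := by
      calc D * ‖ρ‖ ≤ D * (M * B.trace) := by gcongr
        _ = _ := by ring
    rw [← hq] at h2
    rw [← hp] at h3
    rw [abs_le] at *
    constructor <;> linarith
  have hzero : ∀ i, (fun x => f x + q x - p x) (X i) = 0 := by
    intro i
    have := hB.2 i
    simp only [hpx, hρX, ← this, hq]
    ring
  have h := abs_le_eta_mul hd hn hΩ X hm hfill (u := fun x => f x + q x - p x)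
    ((hfs.add hqs.contDiffOn).sub hps) hzero hb x hx
  have h5 := (abs_le.1 h).1
  have h6 : 0 ≤ p x := by rw [hpx ⟨x, hx⟩]; exact hρ0 _
  have h7 : f x - ν / 2 * ‖x‖ ^ 2 + ν * inner ℝ x z - c = f x + q x := by rw [hq]; ring
  rw [h7]
  linarith

lemma eta_nonneg (hm : 2 ≤ m) (X : Fin n → Ω) : 0 ≤ eta Ω X m := by
  have h1 : (0 : ℝ) ≤ (m : ℝ) - 1 := by
    have : (2 : ℝ) ≤ m := by exact_mod_cast hm
    linarith
  have h2 : 0 ≤ fillDistance Ω X :=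
    Real.iSup_nonneg fun _ => Real.iInf_nonneg fun _ => norm_nonneg _
  rw [eta]
  positivity

end ErrorBounds

end KernelSOS

end

theorem mainTheorem7
    {d n : ℕ} (hd : 1 ≤ d) (hn : 1 ≤ n)
    (Ω : Set (KernelSOS.Eucl d)) (r : ℝ) (hΩ : KernelSOS.IsUnionOfBalls Ω r)
    (X : Fin n → Ω) (hX : Function.Injective X)
    (H : Type*) [NormedAddCommGroup H] [InnerProductSpace ℝ H] [CompleteSpace H] [RKHS ℝ H Ω ℝ]
    (m : ℕ) (hm : 2 ≤ m) (M D : ℝ) (hH : KernelSOS.RichSpace H m M D)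
    (f : KernelSOS.Eucl d → ℝ) (hgeom : KernelSOS.GeometricAssumption f Ω)
    (hanalytic : KernelSOS.AnalyticAssumption H f)
    (ζ : KernelSOS.Eucl d) (hζ : KernelSOS.minimizersIn f Ω = {ζ})
    (β : ℝ) (hβ : ∀ x ∈ Ω, β / 2 * ‖x - ζ‖ ^ 2 ≤ f x - f ζ)
    (ν : ℝ) (hν_nonneg : 0 ≤ ν) (hν : ν < β) :
    (∃ (A : H →L[ℝ] H) (τ : ℝ),
      KernelSOS.IsSolutionInf f ν (f ζ + ν / 2 * ‖ζ‖ ^ 2) ζ A ∧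
      LinearMap.rank (A : H →ₗ[ℝ] H) ≤ (d + 1 : ℕ) ∧ KernelSOS.HasTrace A τ) ∧
    ∀ lam : ℝ, 0 < lam →
      (∃ (c : ℝ) (z : KernelSOS.Eucl d) (B : Matrix (Fin n) (Fin n) ℝ),
        KernelSOS.IsSolutionSDP H f X ν lam c z B) ∧
      (KernelSOS.fillDistance Ω X ≤ r / (18 * ((m : ℝ) - 1) ^ 2) →
        2 * M * D * KernelSOS.eta Ω X m ≤ lam →
        ∀ (c : ℝ) (z : KernelSOS.Eucl d) (B : Matrix (Fin n) (Fin n) ℝ),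
          KernelSOS.IsSolutionSDP H f X ν lam c z B →
          ∀ (A : H →L[ℝ] H) (τ : ℝ),
            KernelSOS.IsSolutionInf f ν (f ζ + ν / 2 * ‖ζ‖ ^ 2) ζ A →
            KernelSOS.HasTrace A τ →
            ν / 2 * ‖z - ζ‖ ^ 2 ≤
              3 * KernelSOS.eta Ω X m * (KernelSOS.derivSeminorm Ω m f + ν) + 2 * lam * τ ∧
            |c - ν / 2 * ‖z‖ ^ 2 - f ζ| ≤
              2 * KernelSOS.eta Ω X m * KernelSOS.derivSeminorm Ω m f + lam * τ
                + 2 * KernelSOS.eta Ω X m * ν ∧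
            B.trace ≤
              2 * τ + 2 * (KernelSOS.eta Ω X m / lam) * KernelSOS.derivSeminorm Ω m f
                + 2 * ν * (KernelSOS.eta Ω X m / lam)) := by
  have hζmem : ζ ∈ KernelSOS.minimizersIn f Ω := by rw [hζ]; rfl
  have hsol := KernelSOS.exists_isSolutionInf hH hΩ.isOpen hgeom.contDiff hanalytic hζmem.1 hζmem.2
    hν_nonneg hν hβ
  -- compressions of feasible operators are feasible for the semidefinite program
  have hcomp : ∀ A : H →L[ℝ] H, KernelSOS.IsSolutionInf f ν (f ζ + ν / 2 * ‖ζ‖ ^ 2) ζ A →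
      ∃ B : Matrix (Fin n) (Fin n) ℝ,
        KernelSOS.IsFeasibleSDP H f X ν (f ζ + ν / 2 * ‖ζ‖ ^ 2) ζ B ∧
        ∀ τ, KernelSOS.HasTrace A τ → B.trace ≤ τ := by
    intro A hA
    obtain ⟨B, hB, hBφ, htr⟩ := KernelSOS.exists_compression hH hX hA.1.1
    exact ⟨B, ⟨hB, fun i => by rw [hA.1.2 (X i), hBφ]⟩, htr⟩
  refine ⟨hsol, fun lam hlam => ⟨?_, ?_⟩⟩
  · obtain ⟨A, τ, hA, -, -⟩ := hsol
    obtain ⟨B, hB, -⟩ := hcomp A hA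
    exact KernelSOS.exists_isSolutionSDP hn hν_nonneg hlam hB
  intro hfill hlam2 c z B hB A τ hA hτ
  obtain ⟨B', hB', htr'⟩ := hcomp A hA
  have hopt := hB.2 _ _ _ hB'
  have htrB' := htr' τ hτ
  have hpos := KernelSOS.neg_eta_mul_le_of_isFeasibleSDP hd hn hΩ hX hm hH hanalytic.mem hν_nonneg
    hfill hB.1 hζmem.1
  set η := KernelSOS.eta Ω X m
  set F := KernelSOS.derivSeminorm Ω m f
  have hη : 0 ≤ η := KernelSOS.eta_nonneg hm X
  have hF : 0 ≤ F := KernelSOS.derivSeminorm_nonneg f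
  have htrB : 0 ≤ B.trace := hB.1.1.trace_nonneg
  have hτ0 : 0 ≤ τ := hB'.1.trace_nonneg.trans htrB'
  have h1 : 2 * (η * (M * D * B.trace)) ≤ lam * B.trace := by
    calc 2 * (η * (M * D * B.trace)) = 2 * M * D * η * B.trace := by ring
      _ ≤ lam * B.trace := by gcongr
  have h2 : lam * B'.trace ≤ lam * τ := by gcongr
  have h3 : ‖z - ζ‖ ^ 2 = ‖ζ‖ ^ 2 - 2 * inner ℝ ζ z + ‖z‖ ^ 2 := by
    rw [norm_sub_rev, norm_sub_sq_real]
  have h4 : 0 ≤ ν / 2 * ‖z - ζ‖ ^ 2 := by positivity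
  have hηF : 0 ≤ η * F := by positivity
  have hην : 0 ≤ η * ν := by positivity
  have hlτ : 0 ≤ lam * τ := by positivity
  have hlB : 0 ≤ lam * B.trace := by positivity
  rw [mul_add, mul_add] at hpos
  have h5 : c - ν / 2 * ‖z‖ ^ 2 - f ζ ≤
      -(ν / 2 * ‖z - ζ‖ ^ 2) + η * F + η * ν + lam * B.trace / 2 := by
    rw [h3]; linarith
  have h6 : -(lam * τ) + lam * B.trace ≤ c - ν / 2 * ‖z‖ ^ 2 - f ζ := by linarith
  refine ⟨?_, abs_le.2 ⟨?_, ?_⟩, ?_⟩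
  · linarith
  · linarith
  · linarith
  · have h7 : lam * B.trace ≤ 2 * (lam * τ) + 2 * (η * F) + 2 * (η * ν) := by linarith
    have h8 : 2 * τ + 2 * (η / lam) * F + 2 * ν * (η / lam) =
        (2 * (lam * τ) + 2 * (η * F) + 2 * (η * ν)) / lam := by
      field_simp
    rw [h8, le_div_iff₀ hlam]
    linarith
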